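/- For a vector $\mathbf h=(h_1,\dots,h_n)\in\mathbb Z^n$ let $\mathcal T(\mathbf h)$ be the (finite) set of upper-triangular $n\times n$ matrices $A=(a_{ij})$ with non-negative integer entries such that for each $1\le k\le n$ the $k$-th hook sum satisfies $\sum_{i=k}^{n}a_{ki}-\sum_{i=1}^{k-1}a_{ik}=h_k$ (the Tesler matrices with hook sum $\mathbf h$). Put $L(\mathbf h)=\ln|\mathcal T(\mathbf h)|$, and for positive integers $h,w$ put $L[h,w]=L(h,0,\dots,0)$, where the vector $(h,0,\dots,0)$ has length $w$. As usual, $f\sim g$ means $f/g\to1$. There is a universal constant $\gamma_+>0$ such that both of the following hold. (i) For all $h,w:\mathbb Z^+\to\mathbb Z^+$ with $h(n)\to\infty$, $w(n)\to\infty$ and $\sqrt{h(n)}/w(n)\to0$ as $n\to\infty$, $$L[h(n),w(n)]\sim\gamma_+\,w(n)\sqrt{h(n)}\qquad(n\to\infty).$$ (This property determines $\gamma_+$ uniquely.) (ii) With the same constant $\gamma_+$, the number $|\mathcal T(\mathbf 1^n)|$ of regular Tesler matrices (those of size $n\times n$ with all hook sums equal to $1$) satisfies $$\ln|\mathcal T(\mathbf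 1^n)|\sim\tfrac23\,\gamma_+\,n^{3/2}\qquad(n\to\infty).$$ -/

import Mathlib

namespace Tesler

/-- The `k`-th hook sum of a square matrix with non-negative integer entries:
the entries of row `k` from the diagonal on, minus the entries of column `k` above the diagonal. -/
def hookSum {n : ℕ} (A : Matrix (Fin n) (Fin n) ℕ) (k : Fin n) : ℤ :=
  ∑ i ∈ Finset.Ici k, (A k i : ℤ) - ∑ i ∈ Finset.Iio k, (A i k : ℤ)

/-- The (generalized) Tesler matrices with hook sum vector `h`: the upper-triangular matrices
with non-negative integer entries whose `k`-th hook sum is `h k` for every `k`. -/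
def teslerMatrices {n : ℕ} (h : Fin n → ℤ) : Set (Matrix (Fin n) (Fin n) ℕ) :=
  {A | (∀ i j, j < i → A i j = 0) ∧ ∀ k, hookSum A k = h k}

/-- There are only finitely many Tesler matrices with a given hook sum vector,
so that `Set.ncard` is their number. -/
theorem teslerMatrices_finite {n : ℕ} (h : Fin n → ℤ) : (teslerMatrices h).Finite := by
  have key : ∀ m : ℕ, ∀ k : Fin n, k.val = m →
      ∃ B : ℕ, ∀ A ∈ teslerMatrices h, ∀ j, A k j ≤ B := by
    intro m
    induction m using Nat.strong_induction_on with
    | _ m ih =>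
      intro k hk
      have ih' : ∀ i : Fin n, ∃ B : ℕ, i < k → ∀ A ∈ teslerMatrices h, ∀ j, A i j ≤ B := by
        intro i
        by_cases hi : i < k
        · obtain ⟨B, hB⟩ := ih i.val (by rw [← hk]; exact hi) i rfl
          exact ⟨B, fun _ => hB⟩
        · exact ⟨0, fun h' => absurd h' hi⟩
      choose B hB using ih'
      refine ⟨(h k).natAbs + ∑ i ∈ Finset.Iio k, B i, fun A hA j => ?_⟩
      rcases lt_or_ge j k with hj | hj
      · rw [hA.1 k j hj]
        exact Nat.zero_le _
      · have h1 : (A k j : ℤ) ≤ ∑ i ∈ Finset.Ici k, (A k i : ℤ) :=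
          Finset.single_le_sum (f := fun i => (A k i : ℤ)) (fun i _ => Int.natCast_nonneg _)
            (Finset.mem_Ici.2 hj)
        have h2 : ∑ i ∈ Finset.Iio k, (A i k : ℤ) ≤ ∑ i ∈ Finset.Iio k, (B i : ℤ) :=
          Finset.sum_le_sum fun i hi => by
            exact_mod_cast hB i (Finset.mem_Iio.1 hi) A hA k
        have h3 := hA.2 k
        unfold hookSum at h3
        zify
        have h4 := le_abs_self (h k)
        linarith
  choose B hB using fun k : Fin n => key k.val k rfl
  exact (Set.finite_Iic (fun (i : Fin n) (_ : Fin n) => B i)).subset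
    fun A hA i j => hB i A hA j

/-- `L(h) = ln |T(h)|`. -/
noncomputable def logCard {n : ℕ} (h : Fin n → ℤ) : ℝ :=
  Real.log ((teslerMatrices h).ncard : ℝ)

/-- The hook sum vector `(h, 0, …, 0)` of length `w`. -/
def rectHook (h w : ℕ) : Fin w → ℤ := fun i => if i.val = 0 then (h : ℤ) else 0

end Tesler

/-! A Tesler matrix is an integer flow on the vertices 0, …, n-1 and a sink: entry (i, j) is the
flow on the edge i → j, diagonal entries go to the sink, and hook sums are the net inflows. The flow
through the cut after vertex t is H_t = h_0 + ⋯ + h_t. The theorem is that each cut contributes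
about 2√ζ(2)·√H_t to L, so γ = 2√ζ(2) with ζ(2) = π²/6.

Upper bound (`logCard_le_sum_sqrt`): give each unit of flow on an edge the weight exp(-potential
drop). All Tesler matrices with a given hook vector then have the same weight, so their number times
that weight is at most a product of geometric series. Letting the potential fall by b_t = √ζ(2)/√H_t
across cut t gives at most b_t H_t + ζ(2)/b_t = 2√ζ(2)·√H_t per cut.

Lower bound (`exists_forall_le_log_ncard_longFlows`): edges of length at least 2 may be filled
freely under the cut capacities, since the edges t → t + 1 absorb the slack. Group these edges into
boxes of side s and distribute N_q units arbitrarily in each box at block distance q. A cut meets at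
most q + 1 such boxes, so the constraint is ∑ (q+1) N_q ≤ h. The Bose density N_q ≈ s²/(e^{β(q+1)} -
1), the maximiser of entropy under it, matches the upper bound as β → 0.

For 𝟏ⁿ the cuts are H_t = t + 1: the upper bound sums √(t+1), and the lower bound applies the
constant-capacity case on consecutive blocks of vertices. -/

namespace Tesler

/-! ### Upper bound by weighted counting with potentials -/

open Finset

/-- The entropy-type bound `∑_d -log (1 - e^{-β d}) ≤ ζ(2) / β`. -/
theorem sum_neg_log_one_sub_exp_le {β : ℝ} (hβ : 0 < β) (n : ℕ) :
    ∑ d ∈ range n, -Real.log (1 - Real.exp (-(β * (d + 1)))) ≤ (Real.pi ^ 2 / 6) / β := by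
  have h1 : HasSum (fun m : ℕ => ∑ d ∈ range n,
      Real.exp (-(β * (d + 1))) ^ (m + 1) / ((m : ℝ) + 1))
      (∑ d ∈ range n, -Real.log (1 - Real.exp (-(β * (d + 1))))) := by
    refine hasSum_sum fun d _ => Real.hasSum_pow_div_log_of_abs_lt_one ?_
    rw [abs_of_pos (Real.exp_pos _), Real.exp_lt_one_iff]
    have : 0 < β * ((d : ℝ) + 1) := by positivity
    linarith
  have h2 : HasSum (fun m : ℕ => 1 / ((m : ℝ) + 1) ^ 2 / β) ((Real.pi ^ 2 / 6) / β) := by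
    refine HasSum.div_const ?_ β
    have := (hasSum_nat_add_iff' 1).2 hasSum_zeta_two
    simpa using this
  refine hasSum_le (fun m => ?_) h1 h2
  have hm : (0 : ℝ) < m + 1 := by positivity
  set y := Real.exp (-(β * ((m : ℝ) + 1))) with hy
  have hy0 : 0 < y := Real.exp_pos _
  have hy1 : y < 1 := by
    rw [hy, Real.exp_lt_one_iff]
    have : 0 < β * ((m : ℝ) + 1) := by positivity
    linarith
  have e1 : ∀ d ∈ range n, Real.exp (-(β * ((d : ℝ) + 1))) ^ (m + 1) / ((m : ℝ) + 1) =
      y ^ d * (y / ((m : ℝ) + 1)) := by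
    intro d _
    rw [← Real.exp_nat_mul, hy, mul_div_assoc', ← Real.exp_nat_mul, ← Real.exp_add]
    congr 2
    push_cast
    ring
  rw [sum_congr rfl e1, ← sum_mul]
  have e2 : (∑ d ∈ range n, y ^ d) * (1 - y) ≤ 1 := by
    rw [geom_sum_mul_neg]
    have := pow_pos hy0 n
    linarith
  -- Thus y/(1 - y) ≤ 1/(β(m+1)), which turns the m-th term of the logarithmic series into
  -- 1/(β(m+1)²).
  have e3 : y * (β * ((m : ℝ) + 1)) ≤ 1 - y := by
    have h3 := Real.add_one_le_exp (β * ((m : ℝ) + 1))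
    have h4 : y * Real.exp (β * ((m : ℝ) + 1)) = 1 := by
      rw [hy, ← Real.exp_add]; simp
    nlinarith
  rw [mul_div_assoc', div_div, div_le_div_iff₀ hm (by positivity)]
  have hS : 0 ≤ ∑ d ∈ range n, y ^ d := sum_nonneg fun d _ => by positivity
  nlinarith [mul_le_mul_of_nonneg_left e3 hS]

/-- Enlarging the sum of weights from the Tesler matrices to a full box of entry values makes it
factor into truncated geometric series. -/
theorem ncard_teslerMatrices_mul_le {n : ℕ} (h : Fin n → ℤ) (x : Fin n → Fin n → ℝ) (W : ℝ)
    (h0 : ∀ i j, 0 ≤ x i j) (h1 : ∀ i j, x i j < 1)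
    (hW : ∀ A ∈ teslerMatrices h, ∏ i, ∏ j, x i j ^ A i j = W) :
    ((teslerMatrices h).ncard : ℝ) * W ≤ ∏ i, ∏ j, (1 - x i j)⁻¹ := by
  classical
  set F := (teslerMatrices_finite h).toFinset with hF
  set t : Fin n → Fin n → Finset ℕ := fun i j => F.image fun A => A i j
  have hmem : ∀ A, A ∈ F ↔ A ∈ teslerMatrices h := fun A => Set.Finite.mem_toFinset _
  have hsub : F ⊆ Fintype.piFinset fun i => Fintype.piFinset (t i) := by
    exact fun A hA => Fintype.mem_piFinset.2 fun i => Fintype.mem_piFinset.2 fun j =>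
      mem_image_of_mem (fun A => A i j) hA
  calc ((teslerMatrices h).ncard : ℝ) * W = ∑ A ∈ F, ∏ i, ∏ j, x i j ^ A i j := by
        rw [sum_congr rfl fun A hA => hW A ((hmem A).1 hA), sum_const, nsmul_eq_mul,
          Set.ncard_eq_toFinset_card _ (teslerMatrices_finite h)]
    _ ≤ ∑ A ∈ Fintype.piFinset fun i => Fintype.piFinset (t i), ∏ i, ∏ j, x i j ^ A i j :=
        sum_le_sum_of_subset_of_nonneg hsub fun A _ _ =>
          prod_nonneg fun i _ => prod_nonneg fun j _ => pow_nonneg (h0 i j) _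
    _ = ∏ i, ∏ j, ∑ a ∈ t i j, x i j ^ a := by
        rw [← prod_univ_sum (fun i => Fintype.piFinset (t i)) (fun i r => ∏ j, x i j ^ r j)]
        exact prod_congr rfl fun i _ => (prod_univ_sum (t i) (fun j a => x i j ^ a)).symm
    _ ≤ ∏ i, ∏ j, (1 - x i j)⁻¹ :=
        prod_le_prod (fun i _ => prod_nonneg fun j _ => sum_nonneg fun a _ => pow_nonneg (h0 i j) _)
          fun i _ => prod_le_prod (fun j _ => sum_nonneg fun a _ => pow_nonneg (h0 i j) _)
          fun j _ => sum_le_hasSum _ (fun a _ => pow_nonneg (h0 i j) _)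
            (hasSum_geometric_of_lt_one (h0 i j) (h1 i j))

/-- The potential drop along the edge encoded by the entry `(i, j)`; the diagonal entries encode
the edges to the sink, which has potential `0`. -/
noncomputable def potentialDrop {n : ℕ} (y : Fin n → ℝ) (i j : Fin n) : ℝ :=
  if i = j then y i else y i - y j

/-- Summation by parts on the flow: the energy lost along the edges depends only on the inflows, so
the exponential weight is constant on the Tesler set. -/
theorem sum_mul_potentialDrop {n : ℕ} {h : Fin n → ℤ} (y : Fin n → ℝ)
    {A : Matrix (Fin n) (Fin n) ℕ} (hA : A ∈ teslerMatrices h) :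
    ∑ i, ∑ j, (A i j : ℝ) * potentialDrop y i j = ∑ k, (h k : ℝ) * y k := by
  have e : ∀ k, (h k : ℝ) * y k =
      ∑ i, (if k ≤ i then (A k i : ℝ) * y k else 0) -
        ∑ i, (if i < k then (A i k : ℝ) * y k else 0) := by
    intro k
    rw [← hA.2 k, hookSum]
    push_cast
    rw [sub_mul, sum_mul, sum_mul, ← sum_filter, ← sum_filter]
    congr 1 <;> refine sum_congr ?_ fun _ _ => rfl <;> ext i <;> simp
  simp_rw [e]
  rw [sum_sub_distrib, sum_comm (f := fun k i => if i < k then (A i k : ℝ) * y k else 0),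
    ← sum_sub_distrib]
  refine sum_congr rfl fun i _ => ?_
  rw [← sum_sub_distrib]
  refine sum_congr rfl fun j _ => ?_
  rw [potentialDrop]
  rcases lt_trichotomy i j with hij | hij | hij
  · simp [hij, hij.le, hij.ne, mul_sub]
  · simp [hij]
  · simp [hA.1 i j hij]

theorem logCard_le_sum_potential {n : ℕ} (h : Fin n → ℤ) (y : Fin n → ℝ) (hh : ∀ k, 0 ≤ h k)
    (hy : ∀ i j, i ≤ j → 0 < potentialDrop y i j) (hy0 : ∀ k, 0 < y k) :
    logCard h ≤ ∑ k, (h k : ℝ) * y k +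
      ∑ i, ∑ j, if i ≤ j then -Real.log (1 - Real.exp (-potentialDrop y i j)) else 0 := by
  set x : Fin n → Fin n → ℝ := fun i j =>
    if i ≤ j then Real.exp (-potentialDrop y i j) else 0 with hx
  have h0 : ∀ i j, 0 ≤ x i j := by
    intro i j
    simp only [hx]
    split_ifs
    · exact (Real.exp_pos _).le
    · exact le_rfl
  have h1 : ∀ i j, x i j < 1 := by
    intro i j
    simp only [hx]
    split_ifs with hij
    · have := hy i j hij
      rw [Real.exp_lt_one_iff]
      linarith
    · exact one_pos
  have hW : ∀ A ∈ teslerMatrices h,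
      ∏ i, ∏ j, x i j ^ A i j = Real.exp (-∑ k, (h k : ℝ) * y k) := by
    intro A hA
    rw [← sum_mul_potentialDrop y hA, ← sum_neg_distrib, Real.exp_sum]
    refine prod_congr rfl fun i _ => ?_
    rw [← sum_neg_distrib, Real.exp_sum]
    refine prod_congr rfl fun j _ => ?_
    simp only [hx]
    split_ifs with hij
    · rw [← Real.exp_nat_mul]
      congr 1
      ring
    · simp [hA.1 i j (not_le.1 hij)]
  have hlog : ∀ i j, (if i ≤ j then -Real.log (1 - Real.exp (-potentialDrop y i j)) else 0) =
      Real.log (1 - x i j)⁻¹ := by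
    intro i j
    simp only [hx]
    split_ifs <;> simp
  have hpos : ∀ i j, 0 < (1 - x i j)⁻¹ := fun i j => inv_pos.2 (by linarith [h1 i j])
  have hge : ∀ i j, 1 ≤ (1 - x i j)⁻¹ := fun i j =>
    (one_le_inv₀ (by linarith [h1 i j])).2 (by linarith [h0 i j])
  simp_rw [hlog]
  have key := ncard_teslerMatrices_mul_le h x _ h0 h1 hW
  -- If there were no matrices, `logCard` would be the default value `Real.log 0 = 0`, so
  -- nonnegativity of the right side suffices.
  rcases Nat.eq_zero_or_pos (teslerMatrices h).ncard with hc | hc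
  · rw [logCard, hc]
    simp only [Nat.cast_zero, Real.log_zero]
    refine add_nonneg (sum_nonneg fun k _ => mul_nonneg (by exact_mod_cast hh k) (hy0 k).le)
      (sum_nonneg fun i _ => sum_nonneg fun j _ => Real.log_nonneg (hge i j))
  · have hc' : (0 : ℝ) < (teslerMatrices h).ncard := by exact_mod_cast hc
    have := Real.log_le_log (by positivity) key
    rw [Real.log_mul hc'.ne' (Real.exp_pos _).ne', Real.log_exp,
      Real.log_prod (fun i _ => (prod_pos fun j _ => hpos i j).ne')] at this
    simp_rw [fun i => Real.log_prod (fun j (_ : j ∈ (univ : Finset (Fin n))) => (hpos i j).ne')] at this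
    rw [logCard]
    linarith

/-- The general upper bound `L(h) ≤ 2 √ζ(2) ∑_t √(h_1 + ⋯ + h_t)`. -/
theorem logCard_le_sum_sqrt (f : ℕ → ℤ) (hf : ∀ k, 0 ≤ f k) (h0 : 0 < f 0) (n : ℕ) :
    logCard (fun i : Fin n => f i) ≤
      2 * √(Real.pi ^ 2 / 6) * ∑ t ∈ range n, √((∑ k ∈ range (t + 1), f k : ℤ) : ℝ) := by
  set z : ℝ := √(Real.pi ^ 2 / 6) with hz
  have hz0 : 0 < z := Real.sqrt_pos.2 (by positivity)
  have hzz : z * z = Real.pi ^ 2 / 6 := Real.mul_self_sqrt (by positivity)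
  set F : ℕ → ℝ := fun t => ((∑ k ∈ range (t + 1), f k : ℤ) : ℝ) with hF
  have hF0 : ∀ t, 0 < F t := by
    intro t
    have : 0 < ∑ k ∈ range (t + 1), f k :=
      sum_pos' (fun k _ => hf k) ⟨0, by simp, h0⟩
    simp only [hF]
    exact_mod_cast this
  have hFmono : Monotone F := by
    refine monotone_nat_of_le_succ fun t => ?_
    simp only [hF]
    rw [sum_range_succ _ (t + 1)]
    push_cast
    have : (0 : ℝ) ≤ f (t + 1) := by exact_mod_cast hf (t + 1)
    linarith
  -- This value of b minimises b·F + ζ(2)/b, with both terms equal to √ζ(2)·√F.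
  set b : ℕ → ℝ := fun t => z / √(F t) with hb
  have hb0 : ∀ t, 0 < b t := fun t => div_pos hz0 (Real.sqrt_pos.2 (hF0 t))
  have hbanti : Antitone b := fun s t hst =>
    div_le_div_of_nonneg_left hz0.le (Real.sqrt_pos.2 (hF0 s)) (Real.sqrt_le_sqrt (hFmono hst))
  set Y : ℕ → ℝ := fun i => ∑ t ∈ Ico i n, b t with hY
  have hYn : Y n = 0 := by simp [hY]
  have hYsub : ∀ i j, i ≤ j → j ≤ n → Y i - Y j = ∑ t ∈ Ico i j, b t := by
    intro i j hij hjn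
    simp only [hY]
    rw [← sum_Ico_consecutive b hij hjn]
    ring
  have hYlt : ∀ i j, i < j → j ≤ n → 0 < Y i - Y j := by
    intro i j hij hjn
    rw [hYsub i j hij.le hjn]
    exact sum_pos (fun t _ => hb0 t) (by simpa using hij)
  have hYpos : ∀ k : Fin n, 0 < Y k := by
    intro k
    have := hYlt k n k.2 le_rfl
    rwa [hYn, sub_zero] at this
  have main := logCard_le_sum_potential (fun i : Fin n => f i) (fun i => Y i) (fun k => hf k) ?_ hYpos
  swap
  · intro i j hij
    rw [potentialDrop]
    split_ifs with he
    · exact hYpos i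
    · exact hYlt i j (lt_of_le_of_ne hij he : i < j) j.2.le
  refine main.trans ?_
  set g : ℝ → ℝ := fun s => -Real.log (1 - Real.exp (-s)) with hg
  have A1 : ∑ k : Fin n, ((f k : ℤ) : ℝ) * Y k = ∑ t ∈ range n, b t * F t := by
    rw [Fin.sum_univ_eq_sum_range (fun k => ((f k : ℤ) : ℝ) * Y k) n]
    simp only [hY, hF, mul_sum]
    push_cast
    simp only [mul_sum]
    rw [sum_sigma', sum_sigma']
    refine sum_bij' (fun p _ => ⟨p.2, p.1⟩) (fun p _ => ⟨p.2, p.1⟩) ?_ ?_ ?_ ?_ ?_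
    · rintro ⟨a, c⟩; simp; omega
    · rintro ⟨a, c⟩; simp; omega
    · simp
    · simp
    · rintro ⟨a, c⟩ _; ring
  -- Edges are regrouped by head j + 1; the sink becomes vertex n, where Y vanishes.
  have A2 : ∑ i : Fin n, ∑ j : Fin n, (if i ≤ j then
        -Real.log (1 - Real.exp (-potentialDrop (fun i : Fin n => Y i) i j)) else 0) =
      ∑ j ∈ range n, ∑ i ∈ range (j + 1), g (Y i - Y (j + 1)) := by
    have B1 : ∀ i j : Fin n, (if i ≤ j then
        -Real.log (1 - Real.exp (-potentialDrop (fun i : Fin n => Y i) i j)) else 0) =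
        (if (i : ℕ) < j then g (Y i - Y j) else 0) + if i = j then g (Y i - Y n) else 0 := by
      intro i j
      rw [potentialDrop, hYn, sub_zero]
      rcases lt_trichotomy i j with hij | hij | hij
      · have : (i : ℕ) < j := hij
        simp [hij.le, hij.ne, hij, hg]
      · simp [hij, hg]
      · have : ¬ (i : ℕ) < j := by simpa using hij.le
        simp [hij.not_ge, this, hij.ne']
    simp_rw [B1, sum_add_distrib]
    rw [sum_comm]
    simp only [sum_ite_eq, mem_univ, if_true]
    rw [Fin.sum_univ_eq_sum_range (fun i => g (Y i - Y n)) n,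
      Fin.sum_univ_eq_sum_range (fun j => ∑ i : Fin n, if (i : ℕ) < j then g (Y i - Y j) else 0) n]
    have B2 : ∀ j ∈ range n, (∑ i : Fin n, if (i : ℕ) < j then g (Y i - Y j) else 0) =
        ∑ i ∈ range j, g (Y i - Y j) := by
      intro j hj
      rw [Fin.sum_univ_eq_sum_range (fun i => if i < j then g (Y i - Y j) else 0) n, ← sum_filter]
      refine sum_congr ?_ fun _ _ => rfl
      ext i
      simp at hj ⊢
      omega
    rw [sum_congr rfl B2, ← sum_range_succ (fun j => ∑ i ∈ range j, g (Y i - Y j)),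
      sum_range_succ']
    simp
  rw [A1, A2, ← sum_add_distrib, mul_sum]
  refine sum_le_sum fun j hj => ?_
  have hj' : j < n := by simpa using hj
  have hs : 0 < √(F j) := Real.sqrt_pos.2 (hF0 j)
  have C1 : b j * F j = z * √(F j) := by
    simp only [hb]
    rw [div_mul_eq_mul_div, mul_div_assoc]
    congr 1
    rw [div_eq_iff hs.ne', Real.mul_self_sqrt (hF0 j).le]
  -- Since b is antitone, an edge of length d + 1 ending at j + 1 has drop at least (d + 1)·b j,
  -- which reduces the sum to the ζ(2) bound.
  have C2 : ∑ i ∈ range (j + 1), g (Y i - Y (j + 1)) ≤ z * √(F j) := by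
    rw [← sum_range_reflect]
    have D : ∀ d ∈ range (j + 1), g (Y (j + 1 - 1 - d) - Y (j + 1)) ≤
        -Real.log (1 - Real.exp (-(b j * (d + 1)))) := by
      intro d hd
      have hd' : d ≤ j := by simp at hd; omega
      have hle : b j * (d + 1) ≤ Y (j + 1 - 1 - d) - Y (j + 1) := by
        rw [hYsub _ _ (by omega) (by omega)]
        have := card_nsmul_le_sum (Ico (j + 1 - 1 - d) (j + 1)) b (b j) fun t ht => hbanti (by
          simp at ht; omega)
        rw [Nat.card_Ico, nsmul_eq_mul, show j + 1 - (j + 1 - 1 - d) = d + 1 by omega,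
          Nat.cast_add, Nat.cast_one] at this
        linarith
      have hpos : 0 < b j * ((d : ℝ) + 1) := mul_pos (hb0 j) (by positivity)
      have hlt : Real.exp (-(b j * ((d : ℝ) + 1))) < 1 := by
        rw [Real.exp_lt_one_iff]; linarith
      simp only [hg]
      refine neg_le_neg (Real.log_le_log (by linarith) ?_)
      have := Real.exp_le_exp.2 (neg_le_neg hle)
      linarith
    refine (sum_le_sum D).trans ((sum_neg_log_one_sub_exp_le (hb0 j) (j + 1)).trans (le_of_eq ?_))
    rw [← hzz]
    simp only [hb]
    field_simp
  rw [C1]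
  linarith

end Tesler

/-! ### Flows on long edges under cut capacities -/

namespace Tesler

open Finset

/-- The total flow of `a` on the edges `i → j` with `i ≤ t < j < n`. -/
def cutFlow (a : ℕ → ℕ → ℕ) (n t : ℕ) : ℕ :=
  ∑ i ∈ range (t + 1), ∑ j ∈ Ico (t + 1) n, a i j

/-- The assignments of multiplicities to the edges of length at least two on `n` vertices whose
flow through each cut `t` is at most `H t`. -/
def longFlows (H : ℕ → ℕ) (n : ℕ) : Set (ℕ → ℕ → ℕ) :=
  {a | (∀ i j, a i j ≠ 0 → i + 2 ≤ j ∧ j < n) ∧ ∀ t, cutFlow a n t ≤ H t}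

theorem cutFlow_succ {a : ℕ → ℕ → ℕ} (ha : ∀ i, a i i = 0) {n k : ℕ} (hk : k + 1 < n) :
    cutFlow a n (k + 1) + ∑ i ∈ range (k + 1), a i (k + 1) =
      cutFlow a n k + ∑ j ∈ Ico (k + 1) n, a (k + 1) j := by
  unfold cutFlow
  rw [sum_range_succ _ (k + 1), sum_eq_sum_Ico_succ_bot hk, ha]
  simp_rw [fun i => sum_eq_sum_Ico_succ_bot hk (a i)]
  rw [sum_add_distrib]
  ring

theorem cutFlow_eq_of_le {a : ℕ → ℕ → ℕ} {m n : ℕ} (ha : ∀ i j, a i j ≠ 0 → j < m) (hmn : m ≤ n)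
    (t : ℕ) : cutFlow a n t = cutFlow a m t := by
  refine sum_congr rfl fun i _ => (sum_subset (Ico_subset_Ico_right hmn) fun j hj hj' => ?_).symm
  by_contra h
  have := ha i j h
  simp at hj hj'
  omega

theorem hookSum_of_nat (B : ℕ → ℕ → ℕ) {n : ℕ} (k : Fin n) :
    hookSum (fun i j : Fin n => B i j) k =
      ∑ j ∈ Ico (k : ℕ) n, (B k j : ℤ) - ∑ i ∈ range k, (B i k : ℤ) := by
  have hk := k.2
  unfold hookSum
  congr 1
  · rw [show Finset.Ici k = univ.filter fun i : Fin n => (k : ℕ) ≤ i by ext i; simp, sum_filter,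
      Fin.sum_univ_eq_sum_range (fun j => if (k : ℕ) ≤ j then (B k j : ℤ) else 0) n, ← sum_filter]
    refine sum_congr ?_ fun _ _ => rfl
    ext j
    simp
    omega
  · rw [show Finset.Iio k = univ.filter fun i : Fin n => (i : ℕ) < k by ext i; simp, sum_filter,
      Fin.sum_univ_eq_sum_range (fun i => if i < (k : ℕ) then (B i k : ℤ) else 0) n, ← sum_filter]
    refine sum_congr ?_ fun _ _ => rfl
    ext j
    simp
    omega

/-- Fill the edges `t → t + 1` (and the last edge to the sink) with the slack of the cuts. -/
def completeFlow (H : ℕ → ℕ) (n : ℕ) (a : ℕ → ℕ → ℕ) (i j : ℕ) : ℕ :=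
  a i j + ((if i + 1 = j then H i - cutFlow a n i else 0) +
    (if i = j then (if i + 1 = n then H i else 0) else 0))

/-- After completion every cut carries exactly H t, and the difference of consecutive cuts is the
hook sum. -/
theorem completeFlow_mem {H : ℕ → ℕ} {n : ℕ} {a : ℕ → ℕ → ℕ} (ha : a ∈ longFlows H n)
    (f : ℕ → ℤ) (hf : ∀ t, ∑ k ∈ range (t + 1), f k = H t) :
    (fun i j : Fin n => completeFlow H n a i j : Matrix (Fin n) (Fin n) ℕ) ∈
      teslerMatrices fun i : Fin n => f i := by
  obtain ⟨hsupp, hcut⟩ := ha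
  have hz : ∀ i j, j < i + 2 → a i j = 0 := by
    intro i j hij
    by_contra h
    have := hsupp i j h
    omega
  constructor
  · intro i j hij
    have h1 : (j : ℕ) < i := hij
    simp only [completeFlow]
    rw [hz i j (by omega), if_neg (by omega), if_neg (by omega)]
  · intro k
    rw [hookSum_of_nat (completeFlow H n a)]
    obtain ⟨k, hk⟩ := k
    simp only
    have hout : ∑ j ∈ Ico k n, (completeFlow H n a k j : ℤ) =
        ∑ j ∈ Ico k n, (a k j : ℤ) + ((H k : ℤ) - cutFlow a n k) := by
      simp only [completeFlow]
      push_cast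
      rw [sum_add_distrib, sum_add_distrib, sum_ite_eq, sum_ite_eq]
      -- The last vertex has no successor; its diagonal entry sends everything to the sink.
      rcases eq_or_ne (k + 1) n with h | h
      · have hc : cutFlow a n k = 0 := by simp [cutFlow, h]
        rw [if_neg (by simp; omega), if_pos (by simp; omega), if_pos h, hc]
        simp
      · rw [if_pos (by simp; omega), if_neg h, Nat.cast_sub (hcut k)]
        simp
    rw [hout]
    rcases k with _ | k
    · have h0 := hf 0
      simp only [zero_add, sum_range_one] at h0
      simp only [range_zero, sum_empty, sub_zero, h0]
      have : cutFlow a n 0 = ∑ j ∈ Ico 0 n, a 0 j := by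
        rw [sum_eq_sum_Ico_succ_bot hk, hz 0 0 (by omega)]
        simp [cutFlow]
      rw [this]
      push_cast
      ring
    · have hin : ∑ i ∈ range (k + 1), (completeFlow H n a i (k + 1) : ℤ) =
          ∑ i ∈ range (k + 1), (a i (k + 1) : ℤ) + ((H k : ℤ) - cutFlow a n k) := by
        simp only [completeFlow, add_left_inj]
        push_cast
        rw [sum_add_distrib, sum_add_distrib, sum_ite_eq', sum_ite_eq', if_pos (by simp),
          if_neg (by simp), Nat.cast_sub (hcut k)]
        simp
      rw [hin]
      have h1 := cutFlow_succ (fun i => hz i i (by omega)) hk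
      have h2 := hf (k + 1)
      rw [sum_range_succ, hf k] at h2
      zify at h1
      linarith

theorem completeFlow_injOn (H : ℕ → ℕ) (n : ℕ) :
    Set.InjOn (fun a => (fun i j : Fin n => completeFlow H n a i j : Matrix (Fin n) (Fin n) ℕ))
      (longFlows H n) := by
  intro a ha b hb hab
  funext i j
  by_cases hij : i + 2 ≤ j ∧ j < n
  · have := congrFun (congrFun hab ⟨i, by omega⟩) ⟨j, hij.2⟩
    simp only [completeFlow] at this
    simpa [show i + 1 ≠ j by omega, show i ≠ j by omega] using this
  · exact (by_contra fun h => hij (ha.1 i j h) : a i j = 0).trans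
      (by_contra fun h => hij (hb.1 i j h) : b i j = 0).symm

theorem longFlows_finite (H : ℕ → ℕ) (n : ℕ) : (longFlows H n).Finite := by
  -- H need not be monotone, so these hook sums may be negative.
  set f : ℕ → ℤ := fun k => k.casesOn (H 0 : ℤ) fun k => (H (k + 1) : ℤ) - H k with hf
  have hfs : ∀ t, ∑ k ∈ range (t + 1), f k = H t := by
    intro t
    induction t with
    | zero => simp [hf]
    | succ t ih => rw [sum_range_succ, ih]; simp [hf]
  exact Set.Finite.of_injOn (fun a ha => completeFlow_mem ha f hfs) (completeFlow_injOn H n)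
    (teslerMatrices_finite _)

theorem ncard_longFlows_pos (H : ℕ → ℕ) (n : ℕ) : 0 < (longFlows H n).ncard := by
  rw [Set.ncard_pos (longFlows_finite H n)]
  exact ⟨fun _ _ => 0, by simp, by simp [cutFlow]⟩

theorem log_ncard_longFlows_le_logCard {H : ℕ → ℕ} {n : ℕ} (f : ℕ → ℤ)
    (hf : ∀ t, ∑ k ∈ range (t + 1), f k = H t) :
    Real.log (longFlows H n).ncard ≤ logCard fun i : Fin n => f i := by
  have hle := Set.ncard_le_ncard_of_injOn _ (fun a ha => completeFlow_mem ha f hf)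
    (completeFlow_injOn H n) (teslerMatrices_finite fun i : Fin n => f i)
  exact Real.log_le_log (by exact_mod_cast ncard_longFlows_pos H n) (by exact_mod_cast hle)

theorem longFlows_mono {H H' : ℕ → ℕ} {n n' : ℕ} (hH : ∀ t, t < n → H t ≤ H' t) (hn : n ≤ n') :
    longFlows H n ⊆ longFlows H' n' := by
  rintro a ⟨h1, h2⟩
  refine ⟨fun i j h => ⟨(h1 i j h).1, (h1 i j h).2.trans_le hn⟩, fun t => ?_⟩
  rw [cutFlow_eq_of_le (fun i j h => (h1 i j h).2) hn]
  rcases lt_or_ge t n with ht | ht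
  · exact (h2 t).trans (hH t ht)
  · rw [cutFlow, Ico_eq_empty (by omega)]
    simp

theorem log_ncard_longFlows_mono {H H' : ℕ → ℕ} {n n' : ℕ} (hH : ∀ t, t < n → H t ≤ H' t)
    (hn : n ≤ n') : Real.log (longFlows H n).ncard ≤ Real.log (longFlows H' n').ncard :=
  Real.log_le_log (by exact_mod_cast ncard_longFlows_pos H n)
    (by exact_mod_cast Set.ncard_le_ncard (longFlows_mono hH hn) (longFlows_finite H' n'))

/-- Juxtaposition of a flow on the first `m` vertices and a flow on the vertices from `m` on. -/
def glueFlow (m : ℕ) (p : (ℕ → ℕ → ℕ) × (ℕ → ℕ → ℕ)) (i j : ℕ) : ℕ :=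
  p.1 i j + if m ≤ i ∧ m ≤ j then p.2 (i - m) (j - m) else 0

theorem glueFlow_mem {H : ℕ → ℕ} {m w : ℕ} {p : (ℕ → ℕ → ℕ) × (ℕ → ℕ → ℕ)}
    (hp : p ∈ longFlows H m ×ˢ longFlows (fun t => H (m + t)) w) :
    glueFlow m p ∈ longFlows H (m + w) := by
  obtain ⟨⟨a1, a2⟩, b1, b2⟩ := hp
  constructor
  · intro i j h
    by_cases ha : p.1 i j = 0
    · rw [glueFlow, ha, zero_add] at h
      split_ifs at h with hij
      · have := b1 _ _ h
        omega
      · exact absurd rfl h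
    · have := a1 _ _ ha
      omega
  · intro t
    have hsplit : cutFlow (glueFlow m p) (m + w) t = cutFlow p.1 m t +
        ∑ i ∈ range (t + 1), ∑ j ∈ Ico (t + 1) (m + w),
          if m ≤ i ∧ m ≤ j then p.2 (i - m) (j - m) else 0 := by
      rw [← cutFlow_eq_of_le (fun i j h => (a1 i j h).2) (Nat.le_add_right m w)]
      simp only [cutFlow, glueFlow, sum_add_distrib]
    rw [hsplit]
    rcases lt_or_ge t m with ht | ht
    · rw [sum_eq_zero (s := range (t + 1))]
      · exact a2 t
      · intro i hi
        refine sum_eq_zero fun j _ => if_neg ?_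
        simp at hi
        omega
    · obtain ⟨u, rfl⟩ := Nat.exists_eq_add_of_le ht
      have hz : cutFlow p.1 m (m + u) = 0 := by
        rw [cutFlow, Ico_eq_empty (by omega)]
        simp
      rw [hz, zero_add]
      refine le_trans (le_of_eq ?_) (b2 u)
      rw [add_assoc, sum_range_add, sum_eq_zero (s := range m), zero_add, cutFlow]
      · refine sum_congr rfl fun i _ => ?_
        rw [add_comm m (u + 1), add_comm m w, ← sum_Ico_add']
        refine sum_congr rfl fun j _ => ?_
        simp
      · intro i hi
        refine sum_eq_zero fun j _ => if_neg ?_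
        simp at hi
        omega

theorem glueFlow_injOn (H : ℕ → ℕ) (m w : ℕ) :
    Set.InjOn (glueFlow m) (longFlows H m ×ˢ longFlows (fun t => H (m + t)) w) := by
  have hz : ∀ a ∈ longFlows H m, ∀ i j, m ≤ j → a i j = 0 := by
    intro a ha i j hj
    by_contra h
    have := ha.1 i j h
    omega
  rintro ⟨a, b⟩ ⟨ha, hb⟩ ⟨a', b'⟩ ⟨ha', hb'⟩ hab
  have h : ∀ i j, glueFlow m (a, b) i j = glueFlow m (a', b') i j := fun i j => by rw [hab]
  simp only [glueFlow] at h
  refine Prod.ext ?_ ?_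
  · funext i j
    rcases lt_or_ge j m with hj | hj
    · simpa [hj.not_ge] using h i j
    · exact (hz a ha i j hj).trans (hz a' ha' i j hj).symm
  · funext i j
    have := h (m + i) (m + j)
    rw [hz a ha _ _ (Nat.le_add_right m j), hz a' ha' _ _ (Nat.le_add_right m j)] at this
    simpa using this

/-- Superadditivity: with no edge joining the two groups of vertices, each cut sees only one of the
two flows. -/
theorem log_ncard_longFlows_add (H : ℕ → ℕ) (m w : ℕ) :
    Real.log (longFlows H m).ncard + Real.log (longFlows (fun t => H (m + t)) w).ncard ≤
      Real.log (longFlows H (m + w)).ncard := by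
  have hle := Set.ncard_le_ncard_of_injOn _ (fun p hp => glueFlow_mem hp)
    (glueFlow_injOn H m w) (longFlows_finite H (m + w))
  rw [Set.ncard_prod] at hle
  have h1 := ncard_longFlows_pos H m
  have h2 := ncard_longFlows_pos (fun t => H (m + t)) w
  rw [← Real.log_mul (by positivity) (by positivity)]
  exact Real.log_le_log (by positivity) (by exact_mod_cast hle)

theorem sum_log_ncard_longFlows_le (H : ℕ → ℕ) (w m : ℕ) :
    ∑ b ∈ range m, Real.log (longFlows (fun t => H (b * w + t)) w).ncard ≤
      Real.log (longFlows H (m * w)).ncard := by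
  induction m with
  | zero =>
    simp only [range_zero, sum_empty]
    exact Real.log_natCast_nonneg _
  | succ m ih =>
    rw [sum_range_succ, add_mul, one_mul]
    linarith [log_ncard_longFlows_add H (m * w) w]

end Tesler

/-! ### The box construction -/

namespace Tesler

open Finset

theorem sum_range_mul_eq (f : ℕ → ℕ) (s P : ℕ) :
    ∑ i ∈ range (P * s), f i = ∑ I ∈ range P, ∑ r ∈ range s, f (I * s + r) := by
  induction P with
  | zero => simp
  | succ P ih => rw [sum_range_succ, ← ih, add_mul, one_mul, sum_range_add]

/-- At most q + 1 pairs have u + v = q. Here u and v are the block distances from a cut to the two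
ends of a box crossing it. -/
theorem sum_sum_add_le {N : ℕ → ℕ} {h : ℕ} (hcap : ∀ R, ∑ q ∈ range R, (q + 1) * N q ≤ h)
    (P n : ℕ) : ∑ u ∈ range P, ∑ v ∈ range n, N (u + v) ≤ h := by
  refine le_trans ?_ (hcap (P + n))
  rw [← sum_product' (range P) (range n) (fun u v => N (u + v)),
    ← sum_fiberwise_of_maps_to (s := range P ×ˢ range n) (t := range (P + n))
      (g := fun p => p.1 + p.2) (fun p hp => by simp at hp ⊢; omega)]
  refine sum_le_sum fun q _ => ?_
  rw [sum_congr rfl (g := fun _ => N q) fun p hp => by rw [(mem_filter.1 hp).2], sum_const,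
    smul_eq_mul]
  refine Nat.mul_le_mul_right _ ?_
  rw [← Nat.card_antidiagonal q]
  exact card_le_card fun p hp => mem_antidiagonal.2 (mem_filter.1 hp).2

section

variable {s M : ℕ} {N : ℕ → ℕ}

/-- The multiplicity of the cell `(r, r')` in the box `(I, J)` of a family of multisets. -/
def cellCount (m : ∀ p : Fin M × Fin M, Sym (Fin s × Fin s) (N (p.2 - p.1))) (I J r r' : ℕ) : ℕ :=
  if h : I < M ∧ J < M ∧ r < s ∧ r' < s then
    Multiset.count (⟨r, h.2.2.1⟩, ⟨r', h.2.2.2⟩)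
      (m (⟨I, h.1⟩, ⟨J, h.2.1⟩) : Multiset (Fin s × Fin s))
  else 0

/-- The flow assembled from a multiset of cells for each box of side `s`. -/
def boxFlow (m : ∀ p : Fin M × Fin M, Sym (Fin s × Fin s) (N (p.2 - p.1))) (i j : ℕ) : ℕ :=
  cellCount m (i / s) (j / s) (i % s) (j % s)

theorem sum_cellCount_le (m : ∀ p : Fin M × Fin M, Sym (Fin s × Fin s) (N (p.2 - p.1)))
    (I J : ℕ) : ∑ r ∈ range s, ∑ r' ∈ range s, cellCount m I J r r' ≤ N (J - I) := by
  by_cases h : I < M ∧ J < M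
  · set p : Fin M × Fin M := (⟨I, h.1⟩, ⟨J, h.2⟩) with hp
    have e : ∑ r ∈ range s, ∑ r' ∈ range s, cellCount m I J r r' =
        ∑ x : Fin s × Fin s, Multiset.count x (m p : Multiset (Fin s × Fin s)) := by
      rw [Fintype.sum_prod_type,
        ← Fin.sum_univ_eq_sum_range (fun r => ∑ r' ∈ range s, cellCount m I J r r') s]
      refine sum_congr rfl fun r _ => ?_
      rw [← Fin.sum_univ_eq_sum_range (fun r' => cellCount m I J r r') s]
      refine sum_congr rfl fun r' _ => ?_
      rw [cellCount, dif_pos ⟨h.1, h.2, r.2, r'.2⟩]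
    rw [e, Multiset.sum_count_eq_card (fun _ _ => mem_univ _)]
    exact (Sym.card_coe).le
  · rw [sum_eq_zero]
    · exact Nat.zero_le _
    · refine fun r _ => sum_eq_zero fun r' _ => ?_
      rw [cellCount, dif_neg fun h' => h ⟨h'.1, h'.2.1⟩]

theorem lt_and_ne_zero_of_cellCount_ne_zero
    {m : ∀ p : Fin M × Fin M, Sym (Fin s × Fin s) (N (p.2 - p.1))} {I J r r' : ℕ}
    (h : cellCount m I J r r' ≠ 0) : J < M ∧ N (J - I) ≠ 0 := by
  rw [cellCount] at h
  split_ifs at h with h'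
  · refine ⟨h'.2.1, fun h0 => h ?_⟩
    refine Multiset.count_eq_zero_of_notMem ?_
    have hc := Sym.card_coe (s := m (⟨I, h'.1⟩, ⟨J, h'.2.1⟩))
    rw [Multiset.card_eq_zero.1 (hc.trans h0)]
    exact Multiset.notMem_zero _
  · exact absurd rfl h

theorem boxFlow_mem (hs : 0 < s) (hN : ∀ q, N q ≠ 0 → 2 ≤ q) {h n : ℕ}
    (hcap : ∀ R, ∑ q ∈ range R, (q + 1) * N q ≤ h) (hn : M * s ≤ n)
    (m : ∀ p : Fin M × Fin M, Sym (Fin s × Fin s) (N (p.2 - p.1))) :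
    boxFlow m ∈ longFlows (fun _ => h) n := by
  constructor
  · intro i j hij
    obtain ⟨h1, h2⟩ := lt_and_ne_zero_of_cellCount_ne_zero hij
    have h3 := hN _ h2
    have hj : j < M * s := (Nat.div_lt_iff_lt_mul hs).1 h1
    refine ⟨?_, hj.trans_le hn⟩
    -- Block distance at least 2 forces j - i > s, hence length at least 2.
    have h4 : (i / s + 2) * s ≤ j := (Nat.le_div_iff_mul_le hs).1 (by omega)
    have h5 := Nat.lt_div_mul_add (a := i) hs
    have h6 : (i / s + 2) * s = i / s * s + s + s := by ring
    omega
  · intro t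
    set B := t / s with hB
    have hB1 : B * s ≤ t := Nat.div_mul_le_self t s
    have hB2 : t + 1 ≤ (B + 1) * s := by
      rw [add_mul, one_mul]
      exact Nat.lt_div_mul_add (a := t) hs
    have hblock : ∀ I r, r < s → (I * s + r) / s = I ∧ (I * s + r) % s = r := by
      intro I r hr
      rw [mul_comm, Nat.mul_add_div hs, Nat.mul_add_mod, Nat.div_eq_of_lt hr, Nat.mod_eq_of_lt hr]
      exact ⟨add_zero I, rfl⟩
    calc cutFlow (boxFlow m) n t
        ≤ ∑ i ∈ range ((B + 1) * s), ∑ j ∈ Ico (B * s) (B * s + n * s), boxFlow m i j := by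
          refine (sum_le_sum_of_subset (range_subset_range.2 hB2)).trans
            (sum_le_sum fun i _ => sum_le_sum_of_subset (Ico_subset_Ico (by omega) ?_))
          have := Nat.le_mul_of_pos_right n hs
          omega
      _ = ∑ I ∈ range (B + 1), ∑ J ∈ range n, ∑ r ∈ range s, ∑ r' ∈ range s,
            cellCount m I (B + J) r r' := by
          rw [sum_range_mul_eq]
          refine sum_congr rfl fun I _ => ?_
          rw [sum_comm (s := range n)]
          refine sum_congr rfl fun r hr => ?_
          rw [sum_Ico_eq_sum_range, Nat.add_sub_cancel_left, sum_range_mul_eq]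
          refine sum_congr rfl fun J _ => sum_congr rfl fun r' hr' => ?_
          rw [boxFlow, ← add_assoc, ← add_mul, (hblock I r (mem_range.1 hr)).1,
            (hblock I r (mem_range.1 hr)).2, (hblock (B + J) r' (mem_range.1 hr')).1,
            (hblock (B + J) r' (mem_range.1 hr')).2]
      _ ≤ ∑ I ∈ range (B + 1), ∑ J ∈ range n, N (B + J - I) :=
          sum_le_sum fun I _ => sum_le_sum fun J _ => sum_cellCount_le m I (B + J)
      _ = ∑ u ∈ range (B + 1), ∑ v ∈ range n, N (u + v) := by
          rw [← sum_range_reflect]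
          refine sum_congr rfl fun u hu => sum_congr rfl fun v _ => ?_
          have := mem_range.1 hu
          congr 1
          omega
      _ ≤ h := sum_sum_add_le hcap _ _

theorem boxFlow_injective (hs : 0 < s) : Function.Injective
    (boxFlow : (∀ p : Fin M × Fin M, Sym (Fin s × Fin s) (N (p.2 - p.1))) → ℕ → ℕ → ℕ) := by
  intro m m' hmm
  have hblock : ∀ I r, r < s → (I * s + r) / s = I ∧ (I * s + r) % s = r := by
    intro I r hr
    rw [mul_comm, Nat.mul_add_div hs, Nat.mul_add_mod, Nat.div_eq_of_lt hr, Nat.mod_eq_of_lt hr]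
    exact ⟨add_zero I, rfl⟩
  funext p
  refine Sym.coe_injective (Multiset.ext.2 fun x => ?_)
  obtain ⟨I, J⟩ := p
  obtain ⟨r, r'⟩ := x
  have := congrFun (congrFun hmm (I * s + r)) (J * s + r')
  rw [boxFlow, boxFlow, (hblock I r r.2).1, (hblock I r r.2).2, (hblock J r' r'.2).1,
    (hblock J r' r'.2).2, cellCount, cellCount, dif_pos ⟨I.2, J.2, r.2, r'.2⟩,
    dif_pos ⟨I.2, J.2, r.2, r'.2⟩] at this
  exact this

theorem sum_log_multichoose_le (hs : 0 < s) (hN : ∀ q, N q ≠ 0 → 2 ≤ q) {h n : ℕ}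
    (hcap : ∀ R, ∑ q ∈ range R, (q + 1) * N q ≤ h) (hn : M * s ≤ n) :
    ∑ I ∈ range M, ∑ J ∈ range M, Real.log (Nat.multichoose (s * s) (N (J - I))) ≤
      Real.log (longFlows (fun _ => h) n).ncard := by
  have hcard := Set.ncard_le_ncard_of_injOn
    (s := (Set.univ : Set (∀ p : Fin M × Fin M, Sym (Fin s × Fin s) (N (p.2 - p.1)))))
    boxFlow (fun m _ => boxFlow_mem hs hN hcap hn m) (boxFlow_injective hs).injOn
    (longFlows_finite (fun _ => h) n)
  rw [Set.ncard_univ, Nat.card_eq_fintype_card, Fintype.card_pi] at hcard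
  simp only [Sym.card_sym_eq_multichoose, Fintype.card_prod, Fintype.card_fin] at hcard
  have hpos : ∀ k, 0 < Nat.multichoose (s * s) k := by
    intro k
    rw [Nat.multichoose_eq]
    have := Nat.mul_pos hs hs
    exact Nat.choose_pos (by omega)
  have hlog := Real.log_le_log (x := ((∏ p : Fin M × Fin M, Nat.multichoose (s * s)
    (N (p.2 - p.1)) : ℕ) : ℝ)) (by exact_mod_cast prod_pos fun p _ => hpos _) (Nat.cast_le.2 hcard)
  rw [Nat.cast_prod, Real.log_prod (fun p _ => by exact_mod_cast (hpos _).ne'),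
    Fintype.sum_prod_type, Fin.sum_univ_eq_sum_range (fun I => ∑ J : Fin M,
      Real.log (Nat.multichoose (s * s) (N (J - I)))) M] at hlog
  refine le_trans (le_of_eq (sum_congr rfl fun I _ => ?_)) hlog
  rw [Fin.sum_univ_eq_sum_range (fun J => Real.log (Nat.multichoose (s * s) (N (J - I)))) M]

/-- Only the first M - Q block rows are kept: each of them contains a box at every distance q < Q.
-/
theorem mul_sum_log_multichoose_le (hs : 0 < s) (hN : ∀ q, N q ≠ 0 → 2 ≤ q) {h n : ℕ}
    (hcap : ∀ R, ∑ q ∈ range R, (q + 1) * N q ≤ h) (hn : M * s ≤ n) (Q : ℕ) :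
    ((M : ℝ) - Q) * ∑ q ∈ range Q, Real.log (Nat.multichoose (s * s) (N q)) ≤
      Real.log (longFlows (fun _ => h) n).ncard := by
  refine le_trans ?_ (sum_log_multichoose_le hs hN hcap hn)
  have hnn : ∀ k, 0 ≤ Real.log (Nat.multichoose (s * s) k) := fun k => Real.log_natCast_nonneg _
  calc ((M : ℝ) - Q) * ∑ q ∈ range Q, Real.log (Nat.multichoose (s * s) (N q))
      ≤ ((M - Q : ℕ) : ℝ) * ∑ q ∈ range Q, Real.log (Nat.multichoose (s * s) (N q)) := by
        refine mul_le_mul_of_nonneg_right ?_ (sum_nonneg fun q _ => hnn _)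
        rw [sub_le_iff_le_add]
        have : M ≤ M - Q + Q := by omega
        exact_mod_cast this
    _ = ∑ I ∈ range (M - Q), ∑ q ∈ range Q, Real.log (Nat.multichoose (s * s) (N q)) := by
        rw [sum_const, card_range, nsmul_eq_mul]
    _ ≤ ∑ I ∈ range (M - Q), ∑ J ∈ range M, Real.log (Nat.multichoose (s * s) (N (J - I))) := by
        refine sum_le_sum fun I hI => ?_
        have hI' := mem_range.1 hI
        calc ∑ q ∈ range Q, Real.log (Nat.multichoose (s * s) (N q))
            = ∑ J ∈ Ico I (I + Q), Real.log (Nat.multichoose (s * s) (N (J - I))) := by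
              rw [sum_Ico_eq_sum_range, Nat.add_sub_cancel_left]
              exact sum_congr rfl fun q _ => by rw [Nat.add_sub_cancel_left]
          _ ≤ _ := sum_le_sum_of_subset_of_nonneg
              (fun J hJ => by simp at hJ ⊢; omega) fun J _ _ => hnn _
    _ ≤ _ := sum_le_sum_of_subset_of_nonneg (range_subset_range.2 (Nat.sub_le M Q))
        fun I _ _ => sum_nonneg fun J _ => hnn _

end

end Tesler

/-! ### Entropy asymptotics and Bose sums -/

namespace Tesler

open Finset Filter Topology

/-- The Shannon entropy of the geometric distribution on `ℕ` with mean `μ`. -/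
noncomputable def geometricEntropy (μ : ℝ) : ℝ := (1 + μ) * Real.log (1 + μ) - μ * Real.log μ

theorem tendsto_log_factorial_sub_div :
    Tendsto (fun n : ℕ => (Real.log (n.factorial : ℝ) - n * Real.log n + n) / n) atTop (𝓝 0) := by
  have h1 : Tendsto (fun n : ℕ => Real.log (Stirling.stirlingSeq n) / n) atTop (𝓝 0) :=
    ((Real.continuousAt_log (by positivity)).tendsto.comp
      Stirling.tendsto_stirlingSeq_sqrt_pi).div_atTop tendsto_natCast_atTop_atTop
  have h2 : Tendsto (fun n : ℕ => Real.log (2 * n) / (2 * n)) atTop (𝓝 0) := by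
    have h3 : Tendsto (fun x : ℝ => Real.log x / x) atTop (𝓝 0) :=
      Real.isLittleO_log_id_atTop.tendsto_div_nhds_zero
    exact h3.comp (tendsto_natCast_atTop_atTop.const_mul_atTop two_pos)
  have h4 := h1.add h2
  rw [add_zero] at h4
  refine h4.congr' ?_
  filter_upwards [eventually_gt_atTop 0] with n hn
  have hn' : (0 : ℝ) < n := by exact_mod_cast hn
  rw [Stirling.log_stirlingSeq_formula, Real.log_div hn'.ne' (Real.exp_pos _).ne', Real.log_exp]
  field_simp
  ring

/-- Stirling, centred at log N rather than log u so that the corrections cancel in a binomial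
coefficient. -/
theorem tendsto_log_factorial_div {u N : ℕ → ℕ} {α : ℝ} (hα : 0 < α)
    (hN : Tendsto N atTop atTop)
    (hu : Tendsto (fun s => (u s : ℝ) / N s) atTop (𝓝 α)) :
    Tendsto (fun s => (Real.log ((u s).factorial : ℝ) - u s * Real.log (N s) + u s) / N s) atTop
      (𝓝 (α * Real.log α)) := by
  have hN' : Tendsto (fun s => (N s : ℝ)) atTop atTop := tendsto_natCast_atTop_atTop.comp hN
  have hNpos : ∀ᶠ s in atTop, (0 : ℝ) < N s := hN'.eventually_gt_atTop 0
  have huinf : Tendsto u atTop atTop := by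
    rw [← tendsto_natCast_atTop_iff (R := ℝ)]
    refine (hu.pos_mul_atTop hα hN').congr' ?_
    filter_upwards [hNpos] with s hs
    field_simp
  have h1 := hu.mul (tendsto_log_factorial_sub_div.comp huinf)
  have h2 := hu.mul ((Real.continuousAt_log hα.ne').tendsto.comp hu)
  have h3 := h1.add h2
  rw [mul_zero, zero_add] at h3
  refine h3.congr' ?_
  filter_upwards [hNpos, huinf.eventually_gt_atTop 0] with s hs hus
  have hus' : (0 : ℝ) < u s := by exact_mod_cast hus
  simp only [Function.comp]
  rw [Real.log_div hus'.ne' hs.ne']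
  field_simp
  ring

theorem tendsto_log_multichoose_div {μ : ℝ} (hμ : 0 < μ) :
    Tendsto (fun s : ℕ => Real.log (Nat.multichoose (s * s) ⌊(s * s : ℕ) * μ⌋₊ : ℝ) / (s * s : ℕ))
      atTop (𝓝 (geometricEntropy μ)) := by
  set N : ℕ → ℕ := fun s => s * s
  have hN : Tendsto N atTop atTop := tendsto_id.atTop_mul_atTop₀ tendsto_id
  have hN' : Tendsto (fun s => (N s : ℝ)) atTop atTop := tendsto_natCast_atTop_atTop.comp hN
  have hfl : Tendsto (fun s => (⌊(N s : ℝ) * μ⌋₊ : ℝ) / N s) atTop (𝓝 μ) := by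
    have := (tendsto_nat_floor_mul_div_atTop hμ.le).comp hN'
    simpa only [Function.comp_def, mul_comm μ] using this
  have hinv : Tendsto (fun s => (1 : ℝ) / N s) atTop (𝓝 0) := hN'.const_div_atTop 1
  have e1 := tendsto_log_factorial_div (u := fun s => N s + ⌊(N s : ℝ) * μ⌋₊ - 1)
    (α := 1 + μ) (by positivity) hN (by
      have := (hfl.const_add 1).sub hinv
      rw [sub_zero] at this
      refine this.congr' ?_
      filter_upwards [hN.eventually_gt_atTop 0] with s hs
      have hs' : (0 : ℝ) < N s := by exact_mod_cast hs
      rw [Nat.cast_sub (by omega)]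
      push_cast
      field_simp)
  have e2 := tendsto_log_factorial_div hμ hN hfl
  have e3 := tendsto_log_factorial_div (u := fun s => N s - 1) one_pos hN (by
      have := (tendsto_const_nhds (x := (1 : ℝ))).sub hinv
      rw [sub_zero] at this
      refine this.congr' ?_
      filter_upwards [hN.eventually_gt_atTop 0] with s hs
      have hs' : (0 : ℝ) < N s := by exact_mod_cast hs
      rw [Nat.cast_sub (by omega)]
      push_cast
      field_simp)
  have e := (e1.sub e2).sub e3
  rw [Real.log_one, mul_zero, sub_zero] at e
  refine e.congr' ?_
  filter_upwards [hN.eventually_gt_atTop 0] with s hs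
  have hs' : (0 : ℝ) < N s := by exact_mod_cast hs
  rw [show s * s = N s from rfl]
  set k := ⌊(N s : ℝ) * μ⌋₊
  rw [Nat.multichoose_eq, Nat.cast_choose ℝ (by omega), Real.log_div (by positivity) (by positivity),
    Real.log_mul (by positivity) (by positivity), show N s + k - 1 - k = N s - 1 by omega,
    Nat.cast_sub (by omega), Nat.cast_sub (by omega)]
  push_cast
  field_simp
  ring

theorem hasSum_exp_neg_mul {x : ℝ} (hx : 0 < x) :
    HasSum (fun m : ℕ => Real.exp (-x) ^ (m + 1)) (1 / (Real.exp x - 1)) := by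
  have h1 : Real.exp (-x) < 1 := by rw [Real.exp_lt_one_iff]; linarith
  have h2 := (hasSum_geometric_of_lt_one (Real.exp_pos (-x)).le h1).mul_left (Real.exp (-x))
  have h3 : 1 / (Real.exp x - 1) = Real.exp (-x) * (1 - Real.exp (-x))⁻¹ := by
    have h4 : 0 < Real.exp x - 1 := by linarith [Real.add_one_lt_exp hx.ne']
    rw [Real.exp_neg]
    have := Real.exp_pos x
    field_simp
  rw [h3]
  simpa only [pow_succ'] using h2

/-- Expand in powers of e^{-β(k+1)}; then ∑ k yᵏ = y/(1-y)² ≤ 1/c² for y = e^{-c}, because c/2 ≤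
sinh(c/2). There is no error term, so the capacity constraint holds exactly for every β. -/
theorem sum_mul_bose_le {β : ℝ} (hβ : 0 < β) (n : ℕ) :
    ∑ k ∈ range n, ((k : ℝ) + 1) * (1 / (Real.exp (β * (k + 1)) - 1)) ≤
      (Real.pi ^ 2 / 6) / β ^ 2 := by
  have h1 : HasSum (fun m : ℕ => ∑ k ∈ range n,
      ((k : ℝ) + 1) * Real.exp (-(β * (k + 1))) ^ (m + 1))
      (∑ k ∈ range n, ((k : ℝ) + 1) * (1 / (Real.exp (β * (k + 1)) - 1))) :=
    hasSum_sum fun k _ => (hasSum_exp_neg_mul (by positivity)).mul_left _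
  have h2 : HasSum (fun m : ℕ => 1 / ((m : ℝ) + 1) ^ 2 / β ^ 2) ((Real.pi ^ 2 / 6) / β ^ 2) := by
    refine HasSum.div_const ?_ (β ^ 2)
    have := (hasSum_nat_add_iff' 1).2 hasSum_zeta_two
    simpa using this
  refine hasSum_le (fun m => ?_) h1 h2
  set c : ℝ := β * ((m : ℝ) + 1) with hc
  have hc0 : 0 < c := by positivity
  have hy1 : Real.exp (-c) < 1 := by rw [Real.exp_lt_one_iff]; linarith
  have e1 : ∀ k ∈ range n, ((k : ℝ) + 1) * Real.exp (-(β * ((k : ℝ) + 1))) ^ (m + 1) =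
      ((k + 1 : ℕ) : ℝ) * Real.exp (-c) ^ (k + 1) := by
    intro k _
    rw [← Real.exp_nat_mul, ← Real.exp_nat_mul, hc]
    push_cast
    congr 2
    ring
  have hs := hasSum_coe_mul_geometric_of_norm_lt_one (r := Real.exp (-c))
    (by rwa [Real.norm_eq_abs, abs_of_pos (Real.exp_pos _)])
  have hs' := (hasSum_nat_add_iff' 1).2 hs
  simp only [range_one, sum_singleton, Nat.cast_zero, zero_mul, sub_zero] at hs'
  rw [sum_congr rfl e1]
  refine (sum_le_hasSum (range n) (fun k _ => by positivity) hs').trans ?_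
  have h5 : c / 2 ≤ Real.sinh (c / 2) := Real.self_le_sinh_iff.2 (by positivity)
  rw [Real.sinh_eq] at h5
  set v := Real.exp (-(c / 2)) with hv
  have hv0 : 0 < v := Real.exp_pos _
  have hvv : Real.exp (-c) = v * v := by rw [hv, ← Real.exp_add]; congr 1; ring
  have hvi : v * Real.exp (c / 2) = 1 := by rw [hv, ← Real.exp_add]; simp
  have h6 : c * v ≤ 1 - v * v := by nlinarith
  have h7 : 1 / ((m : ℝ) + 1) ^ 2 / β ^ 2 = 1 / c ^ 2 := by
    rw [hc, mul_pow, div_div, mul_comm]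
  rw [h7, hvv, div_le_div_iff₀ (by rw [hvv] at hy1; nlinarith) (by positivity)]
  nlinarith [mul_self_le_mul_self (by positivity) h6]

theorem geometricEntropy_bose_ge {x : ℝ} (hx : 0 < x) (m₀ : ℕ) :
    ∑ m ∈ range m₀, (1 / ((m : ℝ) + 1) + x) * Real.exp (-x) ^ (m + 1) ≤
      geometricEntropy (1 / (Real.exp x - 1)) := by
  have h1 : Real.exp (-x) < 1 := by rw [Real.exp_lt_one_iff]; linarith
  have h4 : 0 < Real.exp x - 1 := by linarith [Real.add_one_lt_exp hx.ne']
  have s1 := Real.hasSum_pow_div_log_of_abs_lt_one (x := Real.exp (-x))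
    (by rwa [abs_of_pos (Real.exp_pos _)])
  have s2 := (hasSum_exp_neg_mul hx).mul_left x
  have s3 := s1.add s2
  have e : -Real.log (1 - Real.exp (-x)) + x * (1 / (Real.exp x - 1)) =
      geometricEntropy (1 / (Real.exp x - 1)) := by
    have e1 : 1 + 1 / (Real.exp x - 1) = (1 - Real.exp (-x))⁻¹ := by
      rw [Real.exp_neg]
      have := Real.exp_pos x
      field_simp
      ring
    have e2 : 1 / (Real.exp x - 1) = (1 - Real.exp (-x))⁻¹ * Real.exp (-x) := by
      rw [Real.exp_neg]
      have := Real.exp_pos x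
      field_simp
    have hl : Real.log (1 / (Real.exp x - 1)) = -Real.log (1 - Real.exp (-x)) - x := by
      rw [e2, Real.log_mul (inv_pos.2 (by linarith)).ne' (Real.exp_pos _).ne', Real.log_exp,
        Real.log_inv]
      ring
    rw [geometricEntropy, hl, e1, Real.log_inv, ← e1]
    ring
  rw [e] at s3
  refine le_trans (le_of_eq (sum_congr rfl fun m _ => ?_))
    (sum_le_hasSum (range m₀) (fun m _ => by positivity) s3)
  ring

theorem hasSum_add_mul_geometric {r : ℝ} (h0 : 0 ≤ r) (h1 : r < 1) (a b : ℝ) :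
    HasSum (fun k : ℕ => (a + b * ((k : ℝ) + 3)) * r ^ (k + 3))
      (a * (r ^ 3 / (1 - r)) + b * (r / (1 - r) ^ 2 - r - 2 * r ^ 2)) := by
  have s1 := ((hasSum_geometric_of_lt_one h0 h1).mul_left (r ^ 3)).mul_left a
  have s2 := ((hasSum_nat_add_iff' 3).2 (hasSum_coe_mul_geometric_of_norm_lt_one (r := r)
    (by rwa [Real.norm_eq_abs, abs_of_nonneg h0]))).mul_left b
  rw [show (fun k : ℕ => (a + b * ((k : ℝ) + 3)) * r ^ (k + 3)) =
      fun k => a * (r ^ 3 * r ^ k) + b * (((k + 3 : ℕ) : ℝ) * r ^ (k + 3)) by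
        funext k; push_cast; ring,
    show a * (r ^ 3 / (1 - r)) + b * (r / (1 - r) ^ 2 - r - 2 * r ^ 2) =
      a * (r ^ 3 * (1 - r)⁻¹) +
        b * (r / (1 - r) ^ 2 - ∑ k ∈ range 3, (k : ℝ) * r ^ k) by
        simp [sum_range_succ]; ring]
  exact s1.add s2

theorem tendsto_div_one_sub_exp {c : ℝ} (hc : 0 < c) :
    Tendsto (fun β : ℝ => β / (1 - Real.exp (-(c * β)))) (𝓝[>] 0) (𝓝 (1 / c)) := by
  have hd : HasDerivAt (fun β : ℝ => 1 - Real.exp (-(c * β))) c 0 := by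
    have h := (((hasDerivAt_id (0 : ℝ)).const_mul c).neg.exp).const_sub 1
    simpa using h
  have h := hd.tendsto_slope_zero_right
  have h' := h.inv₀ hc.ne'
  rw [one_div]
  refine h'.congr fun β => ?_
  simp [div_eq_mul_inv, mul_comm]

/-- The entropy at 1/(eˣ - 1) is ∑ (1/m + x) e^{-mx} over m ≥ 1. For fixed m, summing over x =
β(k+3) and multiplying by β tends to 1/m² + 1/m² as β → 0. The shift by 3 is q + 1 with q ≥ 2, and
the omitted terms vanish in the limit. -/
theorem exists_le_mul_sum_geometricEntropy {ε : ℝ} (hε : 0 < ε) :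
    ∃ β : ℝ, 0 < β ∧ ∃ K : ℕ, 2 * (Real.pi ^ 2 / 6) - ε ≤
      β * ∑ k ∈ range K, geometricEntropy (1 / (Real.exp (β * (k + 3)) - 1)) := by
  obtain ⟨m₀, hm₀⟩ : ∃ m₀ : ℕ, 2 * (Real.pi ^ 2 / 6) - ε <
      ∑ m ∈ range m₀, 2 * (1 / ((m : ℝ) + 1) ^ 2) := by
    have := ((hasSum_nat_add_iff' 1).2 hasSum_zeta_two).mul_left 2
    have h := this.tendsto_sum_nat.eventually_const_lt
      (show 2 * (Real.pi ^ 2 / 6) - ε < _ by simpa using hε)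
    obtain ⟨m₀, h⟩ := h.exists
    exact ⟨m₀, by simpa using h⟩
  set φ : ℕ → ℝ → ℝ := fun m β =>
    (1 / ((m : ℝ) + 1)) * (Real.exp (-((m + 1) * β)) ^ 3 / (1 - Real.exp (-((m + 1) * β)))) +
      β * (Real.exp (-((m + 1) * β)) / (1 - Real.exp (-((m + 1) * β))) ^ 2
        - Real.exp (-((m + 1) * β)) - 2 * Real.exp (-((m + 1) * β)) ^ 2) with hφ
  have lim : Tendsto (fun β => β * ∑ m ∈ range m₀, φ m β) (𝓝[>] 0)
      (𝓝 (∑ m ∈ range m₀, 2 * (1 / ((m : ℝ) + 1) ^ 2))) := by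
    simp_rw [mul_sum]
    refine tendsto_finsetSum _ fun m _ => ?_
    have hm : (0 : ℝ) < m + 1 := by positivity
    have t1 := tendsto_div_one_sub_exp hm
    have t0 : Tendsto (fun β : ℝ => β) (𝓝[>] 0) (𝓝 0) := nhdsWithin_le_nhds
    have tr : Tendsto (fun β : ℝ => Real.exp (-(((m : ℝ) + 1) * β))) (𝓝[>] 0) (𝓝 1) := by
      have : Continuous fun β : ℝ => Real.exp (-(((m : ℝ) + 1) * β)) := by fun_prop
      have h := this.tendsto 0
      simp only [mul_zero, neg_zero, Real.exp_zero] at h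
      exact h.mono_left nhdsWithin_le_nhds
    have t := (((tr.pow 3).mul t1).const_mul (1 / ((m : ℝ) + 1))).add
      (((t1.pow 2).mul tr).sub ((t0.pow 2).mul (tr.add ((tr.pow 2).const_mul 2))))
    have e : 1 / ((m : ℝ) + 1) * (1 ^ 3 * (1 / ((m : ℝ) + 1))) +
        ((1 / ((m : ℝ) + 1)) ^ 2 * 1 - 0 ^ 2 * (1 + 2 * 1 ^ 2)) = 2 * (1 / ((m : ℝ) + 1) ^ 2) := by
      field_simp
      ring
    rw [e] at t
    refine t.congr fun β => ?_
    simp only [hφ, div_pow]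
    ring
  obtain ⟨β, hβlt, hβ⟩ := ((lim.eventually_const_lt hm₀).and self_mem_nhdsWithin).exists
  have hβ0 : 0 < β := hβ
  refine ⟨β, hβ0, ?_⟩
  have hS : HasSum (fun k : ℕ => ∑ m ∈ range m₀,
      (1 / ((m : ℝ) + 1) + β * ((k : ℝ) + 3)) * Real.exp (-((m + 1) * β)) ^ (k + 3))
      (∑ m ∈ range m₀, φ m β) := by
    refine hasSum_sum fun m _ => ?_
    have hm : (0 : ℝ) < (m + 1) * β := by positivity
    exact hasSum_add_mul_geometric (Real.exp_pos _).le (by rw [Real.exp_lt_one_iff]; linarith) _ _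
  have ht := (hS.mul_left β).tendsto_sum_nat.eventually_const_lt hβlt
  obtain ⟨K, hK⟩ := ht.exists
  refine ⟨K, hK.le.trans ?_⟩
  rw [mul_sum]
  refine sum_le_sum fun k _ => mul_le_mul_of_nonneg_left ?_ hβ0.le
  have hx : 0 < β * ((k : ℝ) + 3) := by positivity
  refine le_trans (le_of_eq (sum_congr rfl fun m _ => ?_)) (geometricEntropy_bose_ge hx m₀)
  rw [← Real.exp_nat_mul, ← Real.exp_nat_mul]
  push_cast
  congr 2
  ring

end Tesler

/-! ### Assembling the bounds -/

namespace Tesler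

open Finset Filter Topology

theorem exists_mul_sq_le_sum_log_multichoose {δ : ℝ} (hδ : 0 < δ) (hδ1 : δ < 1) :
    ∃ β : ℝ, 0 < β ∧ ∃ Q : ℕ, ∃ N : ℕ → ℕ → ℕ, (∀ s q, N s q ≠ 0 → 2 ≤ q) ∧
      (∀ s q, (N s q : ℝ) ≤ (s : ℝ) ^ 2 * (1 / (Real.exp (β * (q + 1)) - 1))) ∧
      ∀ᶠ s : ℕ in atTop, (1 - δ) ^ 2 * (2 * (Real.pi ^ 2 / 6) / β) * (s : ℝ) ^ 2 ≤
        ∑ q ∈ range Q, Real.log (Nat.multichoose (s * s) (N s q)) := by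
  have hζ : 0 < Real.pi ^ 2 / 6 := by positivity
  -- One factor 1 - δ is lost here by fixing β, the other below by taking s finite.
  obtain ⟨β, hβ, K, hK⟩ := exists_le_mul_sum_geometricEntropy
    (ε := 2 * (Real.pi ^ 2 / 6) * δ) (by positivity)
  set S := ∑ k ∈ range K, geometricEntropy (1 / (Real.exp (β * (k + 3)) - 1)) with hS
  have hSge : (1 - δ) * (2 * (Real.pi ^ 2 / 6) / β) ≤ S := by
    rw [mul_div_assoc', div_le_iff₀ hβ]
    linarith
  have hSpos : 0 < S := lt_of_lt_of_le (mul_pos (by linarith) (by positivity)) hSge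
  have hμ : ∀ q : ℕ, 0 < 1 / (Real.exp (β * ((q : ℝ) + 1)) - 1) := by
    intro q
    have : 0 < β * ((q : ℝ) + 1) := by positivity
    have := Real.add_one_lt_exp this.ne'
    exact one_div_pos.2 (by linarith)
  set N : ℕ → ℕ → ℕ := fun s q =>
    if 2 ≤ q then ⌊((s * s : ℕ) : ℝ) * (1 / (Real.exp (β * ((q : ℝ) + 1)) - 1))⌋₊ else 0 with hN
  refine ⟨β, hβ, K + 2, N, ?_, ?_, ?_⟩
  · intro s q h
    by_contra hq
    exact h (by simp only [hN]; rw [if_neg hq])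
  · intro s q
    have hnn : 0 ≤ ((s * s : ℕ) : ℝ) * (1 / (Real.exp (β * ((q : ℝ) + 1)) - 1)) :=
      mul_nonneg (Nat.cast_nonneg _) (hμ q).le
    have hsq : (s : ℝ) ^ 2 = ((s * s : ℕ) : ℝ) := by push_cast; ring
    rw [hsq]
    simp only [hN]
    split_ifs
    · exact Nat.floor_le hnn
    · simpa using hnn
  · have hlim : Tendsto (fun s : ℕ => ∑ k ∈ range K,
        Real.log (Nat.multichoose (s * s) (N s (k + 2))) / (s * s : ℕ)) atTop (𝓝 S) := by
      refine tendsto_finsetSum _ fun k _ => ?_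
      have h := tendsto_log_multichoose_div (hμ (k + 2))
      rw [show β * (((k + 2 : ℕ) : ℝ) + 1) = β * ((k : ℝ) + 3) by push_cast; ring] at h
      refine h.congr fun s => ?_
      simp only [hN]
      rw [if_pos (by omega), show β * (((k + 2 : ℕ) : ℝ) + 1) = β * ((k : ℝ) + 3) by
        push_cast; ring]
    have hev := hlim.eventually_const_lt (show (1 - δ) * S < S by nlinarith)
    filter_upwards [hev, eventually_gt_atTop 0] with s h1 hs
    have hs' : (0 : ℝ) < (s * s : ℕ) := by exact_mod_cast Nat.mul_pos hs hs
    rw [← sum_div, lt_div_iff₀ hs'] at h1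
    rw [sum_range_succ', sum_range_succ']
    have p0 : 0 ≤ Real.log (Nat.multichoose (s * s) (N s 0)) := Real.log_natCast_nonneg _
    have p1 : 0 ≤ Real.log (Nat.multichoose (s * s) (N s (0 + 1))) := Real.log_natCast_nonneg _
    have hsq : (s : ℝ) ^ 2 = ((s * s : ℕ) : ℝ) := by push_cast; ring
    rw [hsq]
    have h2 : (1 - δ) ^ 2 * (2 * (Real.pi ^ 2 / 6) / β) ≤ (1 - δ) * S := by
      have := mul_le_mul_of_nonneg_left hSge (show 0 ≤ 1 - δ by linarith)
      linarith
    have h3 := mul_le_mul_of_nonneg_right h2 hs'.le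
    linarith

/-- The lower bound `L[h, w] ≥ (1 - ε) 2 √ζ(2) w √h` for large `h` and `w ≥ K √h`. -/
theorem exists_forall_le_log_ncard_longFlows {ε : ℝ} (hε : 0 < ε) (hε1 : ε < 1) :
    ∃ (H₀ : ℕ) (K : ℝ), 0 < K ∧ ∀ h w : ℕ, H₀ ≤ h → K * √(h : ℝ) ≤ w →
      (1 - ε) * (2 * √(Real.pi ^ 2 / 6) * w * √(h : ℝ)) ≤
        Real.log (longFlows (fun _ => h) w).ncard := by
  set z : ℝ := √(Real.pi ^ 2 / 6) with hz
  have hz0 : 0 < z := Real.sqrt_pos.2 (by positivity)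
  have hzz : Real.pi ^ 2 / 6 = z * z := (Real.mul_self_sqrt (by positivity)).symm
  -- Four losses of 1 - δ: two in the entropy estimate, one in rounding s, one in the boundary
  -- blocks.
  set δ : ℝ := ε / 4 with hδ
  have hδ0 : 0 < δ := by positivity
  have hδ1 : δ < 1 := by rw [hδ]; linarith
  obtain ⟨β, hβ, Q, N, hN2, hNle, hNev⟩ := exists_mul_sq_le_sum_log_multichoose hδ0 hδ1
  obtain ⟨s₀, hs₀⟩ := eventually_atTop.1 hNev
  have hx : Tendsto (fun h : ℕ => β / z * √(h : ℝ)) atTop atTop :=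
    (Real.tendsto_sqrt_atTop.comp tendsto_natCast_atTop_atTop).const_mul_atTop (by positivity)
  obtain ⟨H₀, hH₀⟩ := eventually_atTop.1
    (hx.eventually_ge_atTop (max (1 / δ) ((s₀ + 1 : ℕ) : ℝ)))
  refine ⟨H₀, (Q + 1) * (β / z) / δ, by positivity, fun h w hh hw => ?_⟩
  -- The side at which the capacity x²·ζ(2)/β² equals h.
  set x : ℝ := β / z * √(h : ℝ) with hxdef
  have hxge := hH₀ h hh
  have hx1 : 1 ≤ δ * x := by
    have := (le_max_left _ _).trans hxge
    rwa [div_le_iff₀ hδ0, mul_comm] at this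
  set s : ℕ := ⌊x⌋₊ with hs
  have hss : s₀ + 1 ≤ s := Nat.le_floor ((le_max_right _ _).trans hxge)
  have hspos : 0 < s := by omega
  have hx0 : 0 ≤ x := by positivity
  have hsx : (s : ℝ) ≤ x := Nat.floor_le hx0
  have hsx' : (1 - δ) * x ≤ s := by
    have := Nat.lt_floor_add_one x
    linarith
  have hcap : ∀ R, ∑ q ∈ range R, (q + 1) * N s q ≤ h := by
    intro R
    have h1 : ∑ q ∈ range R, ((q : ℝ) + 1) * N s q ≤
        (s : ℝ) ^ 2 * ((Real.pi ^ 2 / 6) / β ^ 2) := by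
      refine le_trans ?_ (mul_le_mul_of_nonneg_left (sum_mul_bose_le hβ R) (by positivity))
      rw [mul_sum]
      refine sum_le_sum fun q _ => ?_
      have := mul_le_mul_of_nonneg_left (hNle s q) (show (0 : ℝ) ≤ (q : ℝ) + 1 by positivity)
      linarith
    have h2 : (s : ℝ) ^ 2 * ((Real.pi ^ 2 / 6) / β ^ 2) ≤ h := by
      have h3 : (s : ℝ) ^ 2 ≤ x ^ 2 := pow_le_pow_left₀ (Nat.cast_nonneg s) hsx 2
      have h4 : x ^ 2 * ((Real.pi ^ 2 / 6) / β ^ 2) = h := by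
        rw [hxdef, mul_pow, Real.sq_sqrt (Nat.cast_nonneg h), hzz]
        field_simp
      rw [← h4]
      exact mul_le_mul_of_nonneg_right h3 (by positivity)
    exact_mod_cast h1.trans h2
  have hbox := mul_sum_log_multichoose_le (M := w / s) hspos (hN2 s) hcap
    (Nat.div_mul_le_self w s) Q
  refine le_trans ?_ hbox
  have hT := hs₀ s (by omega)
  have hMs : (w : ℝ) ≤ (w / s : ℕ) * s + s := by
    exact_mod_cast (Nat.lt_div_mul_add (a := w) hspos).le
  have hwx : (Q + 1) * x ≤ δ * w := by
    have h5 := mul_le_mul_of_nonneg_left hw hδ0.le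
    have h6 : δ * ((Q + 1) * (β / z) / δ * √(h : ℝ)) = (Q + 1) * x := by
      rw [hxdef]
      field_simp
    linarith
  have hw1 : (1 - δ) * w ≤ (((w / s : ℕ) : ℝ) - Q) * s := by
    have h7 : ((Q : ℝ) + 1) * s ≤ (Q + 1) * x := mul_le_mul_of_nonneg_left hsx (by positivity)
    linarith
  have hs' : (0 : ℝ) < s := by exact_mod_cast hspos
  have hMQ : 0 ≤ ((w / s : ℕ) : ℝ) - Q :=
    nonneg_of_mul_nonneg_left (le_trans (mul_nonneg (by linarith) (Nat.cast_nonneg w)) hw1) hs'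
  have hd : 0 ≤ 1 - δ := by linarith
  set c : ℝ := (1 - δ) ^ 2 * (2 * (Real.pi ^ 2 / 6) / β) with hc
  have hc0 : 0 ≤ c := by positivity
  calc (1 - ε) * (2 * z * w * √(h : ℝ)) ≤ (1 - δ) ^ 4 * (2 * z * w * √(h : ℝ)) := by
        refine mul_le_mul_of_nonneg_right ?_ (by positivity)
        have := one_add_mul_le_pow (show -2 ≤ -δ by linarith) 4
        have e : (1 : ℝ) + -δ = 1 - δ := by ring
        rw [e] at this
        refine le_trans (le_of_eq ?_) this
        rw [hδ]
        push_cast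
        ring
    _ = ((1 - δ) * w) * (c * ((1 - δ) * x)) := by
        rw [hc, hxdef, hzz]
        field_simp
    _ ≤ ((((w / s : ℕ) : ℝ) - Q) * s) * (c * s) :=
        mul_le_mul hw1 (mul_le_mul_of_nonneg_left hsx' hc0) (by positivity)
          (mul_nonneg hMQ hs'.le)
    _ = (((w / s : ℕ) : ℝ) - Q) * (c * (s : ℝ) ^ 2) := by ring
    _ ≤ _ := mul_le_mul_of_nonneg_left hT hMQ

theorem logCard_rectHook_le {h : ℕ} (hh : 0 < h) (w : ℕ) :
    logCard (rectHook h w) ≤ 2 * √(Real.pi ^ 2 / 6) * w * √(h : ℝ) := by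
  have hs : ∀ t, ∑ k ∈ range (t + 1), (if k = 0 then (h : ℤ) else 0) = h := by
    intro t
    rw [sum_ite_eq', if_pos (by simp)]
  have := logCard_le_sum_sqrt (fun k => if k = 0 then (h : ℤ) else 0)
    (fun k => by split_ifs <;> positivity) (by simpa using hh) w
  simp only [hs, Int.cast_natCast, sum_const, card_range, nsmul_eq_mul] at this
  rw [mul_assoc]
  exact this

theorem log_ncard_longFlows_le_logCard_rectHook (h w : ℕ) :
    Real.log (longFlows (fun _ => h) w).ncard ≤ logCard (rectHook h w) := by
  refine log_ncard_longFlows_le_logCard (fun k => if k = 0 then (h : ℤ) else 0) fun t => ?_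
  rw [sum_ite_eq', if_pos (by simp)]

theorem sum_sqrt_le (n : ℕ) :
    ∑ t ∈ range n, √((t : ℝ) + 1) ≤ 2 / 3 * (((n : ℝ) + 1) * √((n : ℝ) + 1)) := by
  induction n with
  | zero => norm_num
  | succ n ih =>
    rw [sum_range_succ]
    push_cast
    have ha := Real.sq_sqrt (show 0 ≤ (n : ℝ) + 1 by positivity)
    have hd := Real.sq_sqrt (show 0 ≤ (n : ℝ) + 1 + 1 by positivity)
    set a := √((n : ℝ) + 1)
    set d := √((n : ℝ) + 1 + 1)
    have ha0 : 0 ≤ a := Real.sqrt_nonneg _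
    have hd0 : 0 ≤ d := Real.sqrt_nonneg _
    have h1 : 0 ≤ (d - a) ^ 2 * (2 * d + a) := by positivity
    have h2 : a = a * (d ^ 2 - a ^ 2) := by rw [ha, hd]; ring
    rw [← ha] at ih
    rw [← hd]
    nlinarith

theorem le_sum_sqrt (n : ℕ) :
    2 / 3 * ((n : ℝ) * √(n : ℝ)) ≤ ∑ t ∈ range n, √((t : ℝ) + 1) := by
  induction n with
  | zero => simp
  | succ n ih =>
    rw [sum_range_succ]
    push_cast
    have ha := Real.sq_sqrt (show 0 ≤ (n : ℝ) by positivity)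
    have hd := Real.sq_sqrt (show 0 ≤ (n : ℝ) + 1 by positivity)
    set a := √(n : ℝ)
    set d := √((n : ℝ) + 1)
    have ha0 : 0 ≤ a := Real.sqrt_nonneg _
    have hd0 : 0 ≤ d := Real.sqrt_nonneg _
    -- Expands to d³ - 3a²d + 2a³ ≥ 0, the tangent inequality for the cube.
    have h1 : 0 ≤ (d - a) ^ 2 * (d + 2 * a) := by positivity
    have h2 : d = d * (d ^ 2 - a ^ 2) := by rw [ha, hd]; ring
    rw [← ha] at ih
    rw [← hd]
    nlinarith

theorem rpow_three_halves {x : ℝ} (hx : 0 ≤ x) : x ^ (3 / 2 : ℝ) = x * √x := by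
  rw [Real.sqrt_eq_rpow, ← Real.rpow_one_add' hx (by norm_num)]
  norm_num

theorem logCard_one_le (n : ℕ) : logCard (fun _ : Fin n => (1 : ℤ)) ≤
    2 * √(Real.pi ^ 2 / 6) * (2 / 3 * (((n : ℝ) + 1) * √((n : ℝ) + 1))) := by
  have := logCard_le_sum_sqrt (fun _ => 1) (fun _ => zero_le_one) one_pos n
  simp only [sum_const, card_range, nsmul_eq_mul, mul_one] at this
  push_cast at this
  exact this.trans (mul_le_mul_of_nonneg_left (sum_sqrt_le n) (by positivity))

/-- Cut n into m + 1 blocks of width w. On block b the capacities t + 1 are at least b·w, which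
yields about γ·w·√(bw); summing over 1 ≤ b ≤ m gives a Riemann sum for (2/3)γ n^{3/2}. -/
theorem eventually_le_logCard_one {ε : ℝ} (hε : 0 < ε) (hε1 : ε < 1) :
    ∀ᶠ n : ℕ in atTop, (1 - ε) * (2 * √(Real.pi ^ 2 / 6) * (2 / 3 * ((n : ℝ) * √(n : ℝ)))) ≤
      logCard (fun _ : Fin n => (1 : ℤ)) := by
  set g : ℝ := 2 * √(Real.pi ^ 2 / 6) with hg
  have hg0 : 0 ≤ g := by positivity
  set δ : ℝ := ε / 3 with hδ
  have hδ0 : 0 < δ := by positivity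
  have hδ1 : δ < 1 := by rw [hδ]; linarith
  obtain ⟨H₀, K, hK, hlow⟩ := exists_forall_le_log_ncard_longFlows hδ0 hδ1
  obtain ⟨m, hm⟩ := exists_nat_ge (2 / δ)
  have hm0 : (0 : ℝ) < m := lt_of_lt_of_le (by positivity) hm
  -- With K²m ≤ w, the requirement K√((b+1)w) ≤ w holds in all m blocks used.
  obtain ⟨w₀, hw₀⟩ := exists_nat_ge (K ^ 2 * m)
  have hdiv : Tendsto (fun n : ℕ => n / (m + 1)) atTop atTop :=
    Nat.tendsto_div_const_atTop (by omega)
  filter_upwards [hdiv.eventually_ge_atTop (max H₀ w₀),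
    (tendsto_natCast_atTop_atTop (R := ℝ)).eventually_ge_atTop (2 * m / δ)] with n hn1 hn2
  set w := n / (m + 1) with hw
  have hwH : H₀ ≤ w := (le_max_left _ _).trans hn1
  have hwK : K ^ 2 * m ≤ w := hw₀.trans (by exact_mod_cast (le_max_right _ _).trans hn1)
  have hmw : (m + 1) * w ≤ n := Nat.mul_div_le n (m + 1)
  have hmw' : (1 - δ) * n ≤ w * m := by
    have h1 : n < (m + 1) * w + (m + 1) := by
      rw [mul_comm, hw]
      exact Nat.lt_div_mul_add (Nat.succ_pos m)
    have h1' : (n : ℝ) < (m + 1) * w + (m + 1) := by exact_mod_cast h1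
    have h2 : 2 ≤ m * δ := (div_le_iff₀ hδ0).1 hm
    have h3 : 2 * (m : ℝ) ≤ n * δ := (div_le_iff₀ hδ0).1 hn2
    have h4 : (1 - δ) * n * (m + 1) ≤ w * m * (m + 1) := by nlinarith
    exact le_of_mul_le_mul_right h4 (by positivity)
  have step : ∀ b ∈ range m, (1 - δ) * (g * w * √(w : ℝ)) * √((b : ℝ) + 1) ≤
      Real.log (longFlows (fun t => ((b + 1) * w + t) + 1) w).ncard := by
    intro b hb
    have hb' : b + 1 ≤ m := mem_range.1 hb
    refine le_trans ?_ (log_ncard_longFlows_mono (H := fun _ => (b + 1) * w)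
      (fun t _ => by omega) le_rfl)
    refine le_trans (le_of_eq ?_) (hlow ((b + 1) * w) w (hwH.trans
      (Nat.le_mul_of_pos_left w (by omega))) ?_)
    · push_cast
      rw [Real.sqrt_mul (by positivity)]
      ring
    · rw [← Real.sqrt_sq hK.le, ← Real.sqrt_mul (by positivity)]
      refine Real.sqrt_le_iff.2 ⟨Nat.cast_nonneg w, ?_⟩
      push_cast
      have hb'' : (b : ℝ) + 1 ≤ m := by exact_mod_cast hb'
      have h5 : K ^ 2 * ((b : ℝ) + 1) ≤ w :=
        (mul_le_mul_of_nonneg_left hb'' (by positivity)).trans hwK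
      have := mul_le_mul_of_nonneg_right h5 (Nat.cast_nonneg (α := ℝ) w)
      linarith
  have hsum := sum_log_ncard_longFlows_le (fun t => t + 1) w (m + 1)
  -- Block 0, where the constant capacity would be 0, is split off and bounded below by 0.
  rw [sum_range_succ'] at hsum
  have hlast : Real.log (longFlows (fun t => t + 1) ((m + 1) * w)).ncard ≤
      logCard (fun _ : Fin n => (1 : ℤ)) :=
    (log_ncard_longFlows_mono (fun _ _ => le_rfl) hmw).trans
      (log_ncard_longFlows_le_logCard (fun _ => 1) fun t => by simp)
  have hzero : 0 ≤ Real.log (longFlows (fun t => 0 * w + t + 1) w).ncard :=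
    Real.log_natCast_nonneg _
  have hsteps := sum_le_sum step
  rw [← mul_sum] at hsteps
  have hA : 0 ≤ (1 - δ) * (g * w * √(w : ℝ)) := mul_nonneg (by linarith) (by positivity)
  have hsq := mul_le_mul_of_nonneg_left (le_sum_sqrt m) hA
  have hd : 0 ≤ 1 - δ := by linarith
  have hfin : (1 - ε) * (g * (2 / 3 * ((n : ℝ) * √(n : ℝ)))) ≤
      (1 - δ) * (g * w * √(w : ℝ)) * (2 / 3 * ((m : ℝ) * √(m : ℝ))) := by
    have h6 : (1 - δ) * √(n : ℝ) ≤ √((w : ℝ) * m) := by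
      refine Real.le_sqrt_of_sq_le ?_
      rw [mul_pow, Real.sq_sqrt (Nat.cast_nonneg n)]
      refine le_trans ?_ hmw'
      refine mul_le_mul_of_nonneg_right ?_ (Nat.cast_nonneg n)
      nlinarith
    have h7 : ((1 - δ) * n) * ((1 - δ) * √(n : ℝ)) ≤ (w * m) * √((w : ℝ) * m) :=
      mul_le_mul hmw' h6 (by positivity) (by positivity)
    have h8 : 1 - ε ≤ (1 - δ) ^ 3 := by
      have := one_add_mul_le_pow (show -2 ≤ -δ by linarith) 3
      have e : (1 : ℝ) + -δ = 1 - δ := by ring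
      rw [e] at this
      refine le_trans (le_of_eq ?_) this
      rw [hδ]
      push_cast
      ring
    calc (1 - ε) * (g * (2 / 3 * ((n : ℝ) * √(n : ℝ))))
        ≤ (1 - δ) ^ 3 * (g * (2 / 3 * ((n : ℝ) * √(n : ℝ)))) :=
          mul_le_mul_of_nonneg_right h8 (by positivity)
      _ = (1 - δ) * g * (2 / 3) * (((1 - δ) * n) * ((1 - δ) * √(n : ℝ))) := by ring
      _ ≤ (1 - δ) * g * (2 / 3) * ((w * m) * √((w : ℝ) * m)) :=
          mul_le_mul_of_nonneg_left h7 (by positivity)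
      _ = _ := by rw [Real.sqrt_mul (Nat.cast_nonneg w)]; ring
  linarith

end Tesler

theorem mainTheorem2 :
    ∃ γ : ℝ, 0 < γ ∧
      (∀ h w : ℕ → ℕ,
        Filter.Tendsto h Filter.atTop Filter.atTop →
        Filter.Tendsto w Filter.atTop Filter.atTop →
        Asymptotics.IsLittleO Filter.atTop (fun n => √(h n : ℝ)) (fun n => (w n : ℝ)) →
        Asymptotics.IsEquivalent Filter.atTop
          (fun n => Tesler.logCard (Tesler.rectHook (h n) (w n)))
          (fun n => γ * (w n : ℝ) * √(h n : ℝ))) ∧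
      Asymptotics.IsEquivalent Filter.atTop
        (fun n : ℕ => Tesler.logCard (fun _ : Fin n => (1 : ℤ)))
        (fun n : ℕ => (2 / 3 : ℝ) * γ * (n : ℝ) ^ (3 / 2 : ℝ)) := by
  have hg0 : 0 < 2 * √(Real.pi ^ 2 / 6) := mul_pos two_pos (Real.sqrt_pos.2 (by positivity))
  refine ⟨2 * √(Real.pi ^ 2 / 6), hg0, ?_, ?_⟩
  · intro h w hh _ hhw
    refine Asymptotics.isLittleO_iff.2 fun c hc => ?_
    obtain ⟨H₀, K, hK, hlow⟩ := Tesler.exists_forall_le_log_ncard_longFlows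
      (ε := min c (1 / 2)) (lt_min hc (by norm_num))
      ((min_le_right _ _).trans_lt (by norm_num))
    filter_upwards [hh.eventually_ge_atTop H₀, hh.eventually_gt_atTop 0,
      Asymptotics.isLittleO_iff.1 hhw (c := 1 / K) (by positivity)] with n h1 h2 h3
    have hw : K * √(h n : ℝ) ≤ w n := by
      rw [Real.norm_of_nonneg (Real.sqrt_nonneg _), Real.norm_of_nonneg (Nat.cast_nonneg _),
        div_mul_eq_mul_div, one_mul, le_div_iff₀ hK] at h3
      linarith
    have hl := (hlow (h n) (w n) h1 hw).trans
      (Tesler.log_ncard_longFlows_le_logCard_rectHook (h n) (w n))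
    have hu := Tesler.logCard_rectHook_le h2 (w n)
    have hv : 0 ≤ 2 * √(Real.pi ^ 2 / 6) * (w n : ℝ) * √(h n : ℝ) := by positivity
    have hm := mul_le_mul_of_nonneg_right (min_le_left c (1 / 2)) hv
    simp only [Pi.sub_apply]
    rw [Real.norm_of_nonneg hv, Real.norm_eq_abs, abs_le]
    constructor <;> nlinarith
  · refine Asymptotics.isLittleO_iff.2 fun c hc => ?_
    have hlim : Filter.Tendsto (fun n : ℕ => (1 + 1 / (n : ℝ)) * √(1 + 1 / (n : ℝ)))
        Filter.atTop (nhds 1) := by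
      have h1 : Filter.Tendsto (fun n : ℕ => 1 + 1 / (n : ℝ)) Filter.atTop (nhds 1) := by
        simpa using (tendsto_one_div_atTop_nhds_zero_nat (𝕜 := ℝ)).const_add 1
      simpa using h1.mul h1.sqrt
    filter_upwards [Tesler.eventually_le_logCard_one (ε := min c (1 / 2)) (lt_min hc (by norm_num))
      ((min_le_right _ _).trans_lt (by norm_num)),
      hlim.eventually_lt_const (show (1 : ℝ) < 1 + c by linarith),
      Filter.eventually_gt_atTop 0] with n hl hn hn0
    have hn0' : (0 : ℝ) < n := by exact_mod_cast hn0
    have hu := Tesler.logCard_one_le n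
    have e : ((n : ℝ) + 1) * √((n : ℝ) + 1) =
        ((1 + 1 / (n : ℝ)) * √(1 + 1 / (n : ℝ))) * ((n : ℝ) * √(n : ℝ)) := by
      have e1 : (n : ℝ) + 1 = (1 + 1 / (n : ℝ)) * n := by field_simp
      rw [e1, Real.sqrt_mul (by positivity)]
      ring
    have hp : 0 ≤ (n : ℝ) * √(n : ℝ) := by positivity
    have hn' := mul_le_mul_of_nonneg_right hn.le hp
    rw [← e] at hn'
    set g : ℝ := 2 * √(Real.pi ^ 2 / 6)
    have hn'' := mul_le_mul_of_nonneg_left hn' (show 0 ≤ g * (2 / 3) by positivity)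
    have hv : 0 ≤ 2 / 3 * g * ((n : ℝ) * √(n : ℝ)) := by positivity
    have hm := mul_le_mul_of_nonneg_right (min_le_left c (1 / 2)) hv
    simp only [Pi.sub_apply]
    rw [Tesler.rpow_three_halves hn0'.le, Real.norm_of_nonneg hv, Real.norm_eq_abs, abs_le]
    constructor <;> nlinarith
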